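/- Let $f,g:\mathbb{C}\to\widehat{\mathbb{C}}$ be meromorphic functions in the plane, with $g$ non-constant. Suppose that $f$ and $g$ commute: for every $z\in\mathbb{C}$, either $f(g(z))$ and $g(f(z))$ are both defined and equal, or neither is defined (both functions being undefined at $\infty$). Let $F(f)\subset\mathbb{C}$ be the Fatou set of $f$, that is, the set of points having a neighbourhood on which all iterates $f^n$, $n\in\mathbb{N}$, are defined and form a normal family with respect to the spherical metric. Let $U$ be a connected component of $F(f)$ on which some subsequence $(f^{n_k})_{k\ge 1}$ of $(f^n)_{n\ge 1}$ converges locally uniformly to a finite limit function $\varphi:U\to\mathbb{C}$. Then $g(U)\subset F(f)$. -/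

import Mathlib

open Filter Topology

/-- The Riemann sphere. -/
abbrev Sphere : Type := OnePoint ℂ

/-- The uniform structure of the Riemann sphere: the unique one that induces its (compact
Hausdorff) topology, that is, the one of the spherical or chordal metric. -/
noncomputable instance sphereUniformSpace : UniformSpace Sphere := uniformSpaceOfCompactR1

/-- `f : ℂ → Ĉ` is meromorphic in the plane: it is continuous as a map to the sphere and, near
every point, agrees off that point with a complex-valued meromorphic function. The value at a pole
is thus `∞`, and the constant `∞` is not meromorphic. -/
def IsMeromorphicFun (f : ℂ → Sphere) : Prop :=
  Continuous f ∧ ∃ F : ℂ → ℂ, Meromorphic F ∧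
    ∀ z, ∀ᶠ w in 𝓝[≠] z, f w = ((F w : ℂ) : Sphere)

/-- `f` as a self-map of the sphere, with the placeholder value `∞` at `∞`, where `f` is
undefined. Whether a composition is defined is always recorded separately. -/
def sphereExt (f : ℂ → Sphere) : Sphere → Sphere :=
  fun w => w.elim OnePoint.infty f

/-- `f` and `g` commute: at every `z`, either `f (g z)` and `g (f z)` are both defined (that is,
`g z` and `f z` are finite) and equal, or neither is defined. -/
def CommutingFun (f g : ℂ → Sphere) : Prop :=
  ∀ z : ℂ,
    (g z ≠ OnePoint.infty ∧ f z ≠ OnePoint.infty ∧ sphereExt f (g z) = sphereExt g (f z)) ∨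
    (g z = OnePoint.infty ∧ f z = OnePoint.infty)

/-- The `n`-th iterate of `f`, meaningful at the points where `IterDefined f n` holds. -/
def iter (f : ℂ → Sphere) (n : ℕ) (z : ℂ) : Sphere :=
  (sphereExt f)^[n] (z : Sphere)

/-- `fⁿ(z)` is defined: none of `z, f(z), …, fⁿ⁻¹(z)` is `∞`. -/
def IterDefined (f : ℂ → Sphere) (n : ℕ) (z : ℂ) : Prop :=
  ∀ m < n, iter f m z ≠ OnePoint.infty

/-- The family `(Fₙ)` is normal on `V`: every sequence of its members has a subsequence that
converges locally uniformly on `V` with respect to the spherical metric. -/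
def NormalFamilyOn (F : ℕ → ℂ → Sphere) (V : Set ℂ) : Prop :=
  ∀ s : ℕ → ℕ, ∃ φ : ℕ → ℕ, StrictMono φ ∧ ∃ h : ℂ → Sphere,
    TendstoLocallyUniformlyOn (fun k => F (s (φ k))) h atTop V

/-- The Fatou set `F(f) ⊆ ℂ`: the points with a neighbourhood on which all iterates of `f` are
defined and form a normal family. -/
def fatouSet (f : ℂ → Sphere) : Set ℂ :=
  {z | ∃ V : Set ℂ, IsOpen V ∧ z ∈ V ∧ (∀ w ∈ V, ∀ n, IterDefined f n w) ∧
    NormalFamilyOn (iter f) V}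

/-- `U` is a connected component of `F(f)`. -/
def IsFatouComponent (f : ℂ → Sphere) (U : Set ℂ) : Prop :=
  ∃ z ∈ fatouSet f, U = connectedComponentIn (fatouSet f) z

/-!
On an open set `U` where `f^{n_k} → φ` with `φ` finite, no iterate of `f` takes the value `∞`, and
`fⁿ ∘ g = g ∘ fⁿ`. If `∞` has two iterated preimages under `f`, then the iterates of `f` omit them
on `g(U)`, which is open, and Montel's theorem (here by way of Bloch's and Schottky's theorems) puts
`g(U)` into the Fatou set.

Otherwise `f` is a holomorphic self-map of `X = ℂ`, or of `X = ℂ ∖ {a}` with a pole at `a`. Suppose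
that `w = g(z₀)`, with `z₀ ∈ U`, is in the Julia set.

* If `φ(z₀) ∈ X`, then `f^{n_k} ∘ g = g ∘ f^{n_k}` shows that the `f^{n_k}` stay in a compact subset
  of `X` near `w`. Since the forward images of a neighbourhood of a Julia point cover `X` up to one
  point, the maximum principle spreads this boundedness to all of `X`. A limit `H` of the `f^{n_k}`
  is not constant, as a constant limit would be attracting. By Hurwitz's theorem the iterates
  `f^{n_{k+1} - n_k}` are therefore bounded near the Julia point `H(w)`, and they subconverge to the
  identity. So `f` is injective, hence `z ↦ αz + β` or `z ↦ a + 1 / (α(z - a))`, and such a map with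
  iterates tending to the identity has no Julia points in `X`.
* If `φ(z₀) = a`, then `φ` is constant near `z₀` by Hurwitz's theorem, and `f^{n_k} → g(a) = ∞` near
  `w`. This contradicts the density of periodic points at Julia points, which is Montel's theorem
  for functions omitting both `a` and the identity.
-/

open Metric Set

/-! ### Bloch's theorem -/

theorem ball_subset_image_closedBall_of_le_norm_sub {f : ℂ → ℂ} {a : ℂ} {r ε : ℝ} (hr : 0 < r)
    (hε : 0 < ε) (hf : DiffContOnCl ℂ f (ball a r)) (h : ∀ z ∈ sphere a r, ε ≤ ‖f z - f a‖) :
    ball (f a) (ε / 2) ⊆ f '' closedBall a r := by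
  refine hf.ball_subset_image_closedBall hr h fun hconst => ?_
  have hball : EqOn f (fun _ => f a) (ball a r) :=
    (hf.differentiableOn.analyticOnNhd isOpen_ball).eqOn_of_preconnected_of_eventuallyEq
      (fun _ _ => analyticAt_const) (convex_ball a r).isPreconnected (mem_ball_self hr)
      (hconst.mono fun _ => not_not.1)
  have hclosed : EqOn f (fun _ => f a) (closedBall a r) := by
    rw [← closure_ball a hr.ne']
    exact hball.of_subset_closure hf.continuousOn continuousOn_const subset_closure Subset.rfl
  obtain ⟨z, hz⟩ := (NormedSpace.sphere_nonempty (x := a)).2 hr.le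
  have hle := h z hz
  rw [hclosed (sphere_subset_closedBall hz), sub_self, norm_zero] at hle
  exact hε.not_ge hle

theorem norm_sub_sub_deriv_mul_le {f : ℂ → ℂ} {a : ℂ} {r : ℝ}
    (hf : DifferentiableOn ℂ f (ball a r)) (hb : ∀ z ∈ ball a r, ‖deriv f z‖ ≤ 2 * ‖deriv f a‖)
    {z : ℂ} (hz : z ∈ closedBall a (r / 6)) (hr : 0 < r) :
    ‖f z - f a - deriv f a * (z - a)‖ ≤ ‖deriv f a‖ / 2 * ‖z - a‖ := by
  have hsub : closedBall a (r / 6) ⊆ ball a r := closedBall_subset_ball (by linarith)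
  have hmaps : MapsTo (deriv f) (ball a r) (closedBall (deriv f a) (3 * ‖deriv f a‖)) := by
    intro x hx
    rw [mem_closedBall, dist_eq_norm]
    linarith [norm_sub_le (deriv f x) (deriv f a), hb x hx]
  have hderiv : ∀ x ∈ closedBall a (r / 6), ‖deriv f x - deriv f a‖ ≤ ‖deriv f a‖ / 2 := by
    intro x hx
    rw [← dist_eq_norm]
    calc dist (deriv f x) (deriv f a) ≤ 3 * ‖deriv f a‖ / r * dist x a :=
          Complex.dist_le_div_mul_dist_of_mapsTo_ball (hf.deriv isOpen_ball) hmaps (hsub hx)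
      _ ≤ 3 * ‖deriv f a‖ / r * (r / 6) := by gcongr; exact hx
      _ = ‖deriv f a‖ / 2 := by field_simp; ring
  have hmv := (convex_closedBall a (r / 6)).norm_image_sub_le_of_norm_hasDerivWithin_le
    (f := fun x => f x - deriv f a * x) (f' := fun x => deriv f x - deriv f a)
    (fun x hx => by
      simpa using (((hf.differentiableAt (isOpen_ball.mem_nhds (hsub hx))).hasDerivAt.fun_sub
        ((hasDerivAt_id x).const_mul (deriv f a))).hasDerivWithinAt))
    hderiv (mem_closedBall_self (by positivity)) hz
  rwa [show f z - f a - deriv f a * (z - a) = f z - deriv f a * z - (f a - deriv f a * a) by ring]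

theorem ball_subset_image_of_norm_deriv_le {f : ℂ → ℂ} {a : ℂ} {r : ℝ}
    (hf : DifferentiableOn ℂ f (ball a r)) (hr : 0 < r) (h0 : deriv f a ≠ 0)
    (hb : ∀ z ∈ ball a r, ‖deriv f z‖ ≤ 2 * ‖deriv f a‖) :
    ball (f a) (r * ‖deriv f a‖ / 24) ⊆ f '' ball a r := by
  have hsub : closedBall a (r / 6) ⊆ ball a r := closedBall_subset_ball (by linarith)
  have hsphere : ∀ z ∈ sphere a (r / 6), r * ‖deriv f a‖ / 12 ≤ ‖f z - f a‖ := by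
    intro z hz
    have hza : ‖z - a‖ = r / 6 := by rwa [← mem_sphere_iff_norm]
    have happrox := norm_sub_sub_deriv_mul_le hf hb (sphere_subset_closedBall hz) hr
    have htri := norm_sub_norm_le (deriv f a * (z - a)) (f z - f a)
    rw [norm_sub_rev (deriv f a * (z - a)), norm_mul, hza] at htri
    rw [hza] at happrox
    linarith
  have himage := ball_subset_image_closedBall_of_le_norm_sub (by positivity) (by positivity)
    (hf.mono (closure_ball_subset_closedBall.trans hsub)).diffContOnCl hsphere
  refine Subset.trans (ball_subset_ball ?_) (himage.trans (image_mono hsub))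
  linarith

theorem exists_ball_forall_le_two_mul {X : Type*} [PseudoMetricSpace X] [ProperSpace X]
    {u : X → ℝ} {c : X} {ρ : ℝ} (hρ : 0 < ρ) (hu : ContinuousOn u (closedBall c ρ))
    (hc : 0 < u c) :
    ∃ a r, 0 < r ∧ ball a r ⊆ closedBall c ρ ∧ ρ * u c ≤ 2 * (r * u a) ∧
      ∀ x ∈ ball a r, u x ≤ 2 * u a := by
  obtain ⟨a, ha, hmax⟩ := (isCompact_closedBall c ρ).exists_isMaxOn
    ⟨c, mem_closedBall_self hρ.le⟩ (hu.mul (g := fun x => ρ - dist x c) (by fun_prop))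
  have hca : u c * ρ ≤ u a * (ρ - dist a c) := by
    simpa using hmax (mem_closedBall_self hρ.le)
  have hpos : 0 < u a * (ρ - dist a c) := lt_of_lt_of_le (by positivity) hca
  have hr : 0 < ρ - dist a c :=
    (sub_nonneg.2 (mem_closedBall.1 ha)).lt_of_ne' (right_ne_zero_of_mul hpos.ne')
  have hua : 0 < u a := pos_of_mul_pos_left hpos hr.le
  have hdist : ∀ x ∈ ball a ((ρ - dist a c) / 2), (ρ - dist a c) / 2 ≤ ρ - dist x c := by
    intro x hx
    linarith [dist_triangle x a c, mem_ball.1 hx]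
  have hsub : ball a ((ρ - dist a c) / 2) ⊆ closedBall c ρ := fun x hx =>
    mem_closedBall.2 (by linarith [hdist x hx])
  refine ⟨a, (ρ - dist a c) / 2, half_pos hr, hsub, by linarith, fun x hx => ?_⟩
  by_contra! hlt
  have hxa : u x * (ρ - dist x c) ≤ u a * (ρ - dist a c) := hmax (hsub hx)
  have hscaled : u x * ((ρ - dist a c) / 2) ≤ u x * (ρ - dist x c) := by
    gcongr
    · linarith
    · exact hdist x hx
  have hstrict := mul_lt_mul_of_pos_right hlt (half_pos hr)
  linarith

theorem exists_ball_subset_image_of_bloch {f : ℂ → ℂ} {c : ℂ} {R : ℝ}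
    (hf : DifferentiableOn ℂ f (ball c R)) :
    ∃ w, ball w (R * ‖deriv f c‖ / 72) ⊆ f '' ball c R := by
  rcases le_or_gt (R * ‖deriv f c‖) 0 with hle | hpos
  · exact ⟨0, by rw [ball_eq_empty.2 (by linarith)]; exact empty_subset _⟩
  have hR : 0 < R := pos_of_mul_pos_left hpos (norm_nonneg _)
  have hsub : closedBall c (2 * R / 3) ⊆ ball c R := closedBall_subset_ball (by linarith)
  obtain ⟨a, r, hr, hball, hle, hbound⟩ := exists_ball_forall_le_two_mul
    (u := fun z => ‖deriv f z‖) (by positivity : 0 < 2 * R / 3)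
    ((hf.deriv isOpen_ball).continuousOn.mono hsub).norm (pos_of_mul_pos_right hpos hR.le)
  have ha : deriv f a ≠ 0 := fun h => by
    rw [h, norm_zero] at hle
    linarith
  refine ⟨f a, (ball_subset_ball ?_).trans <| (ball_subset_image_of_norm_deriv_le
    (hf.mono (hball.trans hsub)) hr ha hbound).trans (image_mono (hball.trans hsub))⟩
  linarith

theorem mul_norm_deriv_le_of_forall_not_ball_subset_image {f : ℂ → ℂ} {c : ℂ} {R : ℝ}
    (hf : DifferentiableOn ℂ f (ball c R)) (hno : ∀ w, ¬ ball w 1 ⊆ f '' ball c R) :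
    R * ‖deriv f c‖ ≤ 72 := by
  by_contra! hlt
  obtain ⟨w, hw⟩ := exists_ball_subset_image_of_bloch hf
  exact hno w ((ball_subset_ball (by linarith)).trans hw)

/-! ### Schottky's theorem -/

theorem exists_exp_eq_on_ball {u : ℂ → ℂ} {c : ℂ} {R : ℝ} (hR : 0 < R)
    (hu : DifferentiableOn ℂ u (ball c R)) (h0 : ∀ z ∈ ball c R, u z ≠ 0) :
    ∃ v : ℂ → ℂ, v c = Complex.log (u c) ∧ DifferentiableOn ℂ v (ball c R) ∧
      ∀ z ∈ ball c R, Complex.exp (v z) = u z := by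
  have hc : c ∈ ball c R := mem_ball_self hR
  obtain ⟨v, hvc, hv⟩ := (((hu.deriv isOpen_ball).div hu h0).isExactOn_ball).with_val_at c
    (Complex.log (u c))
  have hderiv : ∀ z ∈ ball c R, HasDerivAt (fun z => u z * Complex.exp (-v z)) 0 z := by
    intro z hz
    refine HasDerivAt.congr_deriv
      (((hu.differentiableAt (isOpen_ball.mem_nhds hz)).hasDerivAt).mul (hv z hz).neg.cexp) ?_
    have hz0 := h0 z hz
    simp only [Pi.div_apply, Pi.neg_apply]
    field_simp
    ring
  refine ⟨v, hvc, fun z hz => (hv z hz).differentiableAt.differentiableWithinAt, fun z hz => ?_⟩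
  have hconst : u z * Complex.exp (-v z) = u c * Complex.exp (-v c) :=
    isOpen_ball.is_const_of_deriv_eq_zero (convex_ball c R).isPreconnected
      (fun x hx => (hderiv x hx).differentiableAt.differentiableWithinAt)
      (fun x hx => (hderiv x hx).deriv) hz hc
  rw [hvc, Complex.exp_neg (Complex.log _), Complex.exp_log (h0 c hc),
    mul_inv_cancel₀ (h0 c hc), Complex.exp_neg] at hconst
  exact (eq_of_mul_inv_eq_one hconst).symm

theorem exists_sq_eq_on_ball {u : ℂ → ℂ} {c : ℂ} {R : ℝ} (hR : 0 < R)
    (hu : DifferentiableOn ℂ u (ball c R)) (h0 : ∀ z ∈ ball c R, u z ≠ 0) :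
    ∃ h : ℂ → ℂ, DifferentiableOn ℂ h (ball c R) ∧ ∀ z ∈ ball c R, h z ^ 2 = u z := by
  obtain ⟨v, -, hvd, hv⟩ := exists_exp_eq_on_ball hR hu h0
  refine ⟨fun z => Complex.exp (v z / 2), (hvd.div_const 2).cexp, fun z hz => ?_⟩
  rw [← hv z hz, ← Complex.exp_nat_mul, Nat.cast_ofNat, mul_div_cancel₀ _ two_ne_zero]

theorem norm_log_le {p : ℂ} {M : ℝ} (hp0 : p ≠ 0) (hp : ‖p‖ ≤ M) (hp' : ‖p⁻¹‖ ≤ M) :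
    ‖Complex.log p‖ ≤ M - 1 + Real.pi := by
  have hpos : 0 < ‖p‖ := norm_pos_iff.2 hp0
  have hre : |(Complex.log p).re| ≤ M - 1 := by
    rw [norm_inv] at hp'
    rw [Complex.log_re, abs_le]
    constructor
    · linarith [Real.one_sub_inv_le_log_of_pos hpos]
    · linarith [Real.log_le_sub_one_of_pos hpos]
  have him : |(Complex.log p).im| ≤ Real.pi := by
    rw [Complex.log_im]
    exact Complex.abs_arg_le_pi p
  linarith [Complex.norm_le_abs_re_add_abs_im (Complex.log p)]

theorem cos_neg_I_mul_eq_of_exp_eq {w p q : ℂ} (hw : Complex.exp w = p) (hpq : p * q = 1) :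
    Complex.cos (-Complex.I * w) = (p + q) / 2 := by
  have hq : Complex.exp (-w) = q := by
    rw [Complex.exp_neg, hw, inv_eq_of_mul_eq_one_right hpq]
  rw [neg_mul, Complex.cos_neg, mul_comm, Complex.cos_mul_I, Complex.cosh, hw, hq]

theorem exists_cos_pi_mul_eq_on_ball {f : ℂ → ℂ} {c : ℂ} {R : ℝ} (hR : 0 < R)
    (hf : DifferentiableOn ℂ f (ball c R)) (h1 : ∀ z ∈ ball c R, f z ≠ 1)
    (h2 : ∀ z ∈ ball c R, f z ≠ -1) :
    ∃ F : ℂ → ℂ, DifferentiableOn ℂ F (ball c R) ∧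
      (∀ z ∈ ball c R, Complex.cos (Real.pi * F z) = f z) ∧ ‖F c‖ ≤ 2 * ‖f c‖ + 1 := by
  have hc : c ∈ ball c R := mem_ball_self hR
  have hne : ∀ z ∈ ball c R, 1 - f z ^ 2 ≠ 0 := fun z hz h =>
    (sq_eq_one_iff.1 (sub_eq_zero.1 h).symm).elim (h1 z hz) (h2 z hz)
  obtain ⟨h, hhd, hsq⟩ := exists_sq_eq_on_ball hR (u := fun z => 1 - f z ^ 2)
    ((differentiableOn_const 1).sub (hf.pow 2)) hne
  have hprod : ∀ z ∈ ball c R, (f z + Complex.I * h z) * (f z - Complex.I * h z) = 1 := by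
    intro z hz
    linear_combination hsq z hz - h z ^ 2 * Complex.I_sq
  obtain ⟨w, hwc, hwd, hw⟩ := exists_exp_eq_on_ball hR (u := fun z => f z + Complex.I * h z)
    (hf.add (hhd.const_mul Complex.I)) fun z hz => left_ne_zero_of_mul_eq_one (hprod z hz)
  have hpi : (Real.pi : ℂ) ≠ 0 := by exact_mod_cast Real.pi_ne_zero
  refine ⟨fun z => -Complex.I * w z / Real.pi, (hwd.const_mul _).div_const _, fun z hz => ?_, ?_⟩
  · rw [mul_div_cancel₀ _ hpi, cos_neg_I_mul_eq_of_exp_eq (hw z hz) (hprod z hz)]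
    ring
  have hhc : ‖h c‖ ≤ 1 + ‖f c‖ := by
    have hsq' : ‖h c‖ ^ 2 ≤ 1 + ‖f c‖ ^ 2 := by
      rw [← norm_pow, hsq c hc]
      exact (norm_sub_le _ _).trans_eq (by rw [norm_one, norm_pow])
    nlinarith [norm_nonneg (h c), norm_nonneg (f c)]
  have hIh : ‖Complex.I * h c‖ = ‖h c‖ := by rw [norm_mul, Complex.norm_I, one_mul]
  have hwbound : ‖w c‖ ≤ 2 * ‖f c‖ + 1 - 1 + Real.pi := by
    rw [hwc]
    refine norm_log_le (left_ne_zero_of_mul_eq_one (hprod c hc)) ?_ ?_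
    · exact (norm_add_le _ _).trans (by linarith)
    · rw [inv_eq_of_mul_eq_one_right (hprod c hc)]
      exact (norm_sub_le _ _).trans (by linarith)
  rw [norm_div, norm_mul, norm_neg, Complex.norm_I, one_mul, Complex.norm_real,
    Real.norm_of_nonneg Real.pi_pos.le, div_le_iff₀ Real.pi_pos]
  nlinarith [norm_nonneg (f c), Real.pi_gt_three]

theorem two_le_cosh_pi_div_two : 2 ≤ Real.cosh (Real.pi / 2) := by
  have hexp : 4 ≤ Real.exp (3 / 2) := by
    rw [show (3 / 2 : ℝ) = 1 + 1 / 2 by norm_num, Real.exp_add]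
    nlinarith [Real.exp_one_gt_d9, Real.add_one_le_exp (1 / 2 : ℝ)]
  have hmono : Real.exp (3 / 2) ≤ Real.exp (Real.pi / 2) := by
    gcongr
    exact Real.pi_gt_three.le
  rw [Real.cosh_eq]
  linarith [Real.exp_pos (-(Real.pi / 2))]

theorem cosh_pi_mul_add_one_le {y : ℝ} (hy : 0 ≤ y) :
    Real.cosh (Real.pi * y) + 1 ≤ Real.cosh (Real.pi * y + Real.pi / 2) := by
  have hsinh : 0 ≤ Real.sinh (Real.pi * y) * Real.sinh (Real.pi / 2) :=
    mul_nonneg (Real.sinh_nonneg_iff.2 (by positivity)) (Real.sinh_nonneg_iff.2 (by positivity))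
  rw [Real.cosh_add]
  nlinarith [two_le_cosh_pi_div_two, Real.one_le_cosh (Real.pi * y)]

theorem exists_cosh_pi_mul_eq_nat_of_nonneg {y : ℝ} (hy : 0 ≤ y) :
    ∃ t, |t - y| ≤ 1 / 2 ∧ ∃ n : ℕ, Real.cosh (Real.pi * t) = n := by
  have hcont : ContinuousOn (fun t => Real.cosh (Real.pi * t)) (Icc y (y + 1 / 2)) :=
    (Real.continuous_cosh.comp (continuous_const_mul Real.pi)).continuousOn
  have hstep := cosh_pi_mul_add_one_le hy
  rw [show Real.pi * y + Real.pi / 2 = Real.pi * (y + 1 / 2) by ring] at hstep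
  obtain ⟨t, ht, htn⟩ := intermediate_value_Icc (by linarith) hcont
    ⟨Nat.le_ceil _, (Nat.ceil_lt_add_one (Real.cosh_pos (Real.pi * y)).le).le.trans hstep⟩
  exact ⟨t, abs_le.2 ⟨by linarith [ht.1], by linarith [ht.2]⟩, _, htn⟩

theorem exists_cosh_pi_mul_eq_nat (y : ℝ) :
    ∃ t, |t - y| ≤ 1 / 2 ∧ ∃ n : ℕ, Real.cosh (Real.pi * t) = n := by
  rcases le_total 0 y with hy | hy
  · exact exists_cosh_pi_mul_eq_nat_of_nonneg hy
  · obtain ⟨t, ht, n, hn⟩ := exists_cosh_pi_mul_eq_nat_of_nonneg (neg_nonneg.2 hy)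
    refine ⟨-t, ?_, n, by rw [mul_neg, Real.cosh_neg, hn]⟩
    rwa [← abs_neg, show -(-t - y) = t - -y by ring]

theorem exists_mem_ball_cos_pi_mul_eq_int (w : ℂ) :
    ∃ p ∈ ball w 1, ∃ n : ℤ, Complex.cos (Real.pi * p) = n := by
  obtain ⟨t, ht, n, hn⟩ := exists_cosh_pi_mul_eq_nat w.im
  have hre : |(round w.re : ℝ) - w.re| ≤ 1 / 2 := by
    rw [abs_sub_comm]
    exact abs_sub_round w.re
  refine ⟨round w.re + t * Complex.I, ?_, Int.negOnePow (round w.re) * n, ?_⟩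
  · rw [mem_ball_iff_norm, ← sq_lt_one_iff₀ (norm_nonneg _), Complex.sq_norm,
      Complex.normSq_apply]
    have hre' : ((round w.re : ℂ) + t * Complex.I - w).re = round w.re - w.re := by simp
    have him' : ((round w.re : ℂ) + t * Complex.I - w).im = t - w.im := by simp
    rw [hre', him', ← sq, ← sq]
    linarith [sq_le_sq' (abs_le.1 hre).1 (abs_le.1 hre).2,
      sq_le_sq' (abs_le.1 ht).1 (abs_le.1 ht).2]
  · rw [show (Real.pi : ℂ) * (round w.re + t * Complex.I)
        = ((Real.pi * t : ℝ) : ℂ) * Complex.I + round w.re * Real.pi by push_cast; ring,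
      Complex.cos_antiperiodic.add_int_mul_eq, Complex.cos_mul_I, ← Complex.ofReal_cosh, hn]
    push_cast
    rfl

theorem cos_pi_mul_int_eq_one_or (n : ℤ) :
    Complex.cos (Real.pi * n) = 1 ∨ Complex.cos (Real.pi * n) = -1 := by
  have hcos : Complex.cos (Real.pi * n) = (-1) ^ n := by
    simpa [mul_comm] using congrArg Complex.ofReal (Real.cos_int_mul_pi n)
  rw [hcos]
  exact (Int.even_or_odd n).imp Even.neg_one_zpow Odd.neg_one_zpow

theorem exists_double_arccos_on_ball {f : ℂ → ℂ} {c : ℂ} {R : ℝ} (hR : 0 < R)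
    (hf : DifferentiableOn ℂ f (ball c R)) (h0 : ∀ z ∈ ball c R, f z ≠ 0)
    (h1 : ∀ z ∈ ball c R, f z ≠ 1) :
    ∃ G : ℂ → ℂ, DifferentiableOn ℂ G (ball c R) ∧
      (∀ z ∈ ball c R, Complex.cos (Real.pi * Complex.cos (Real.pi * G z)) = 2 * f z - 1) ∧
      (∀ w, ¬ ball w 1 ⊆ G '' ball c R) ∧ ‖G c‖ ≤ 8 * ‖f c‖ + 7 := by
  obtain ⟨F, hFd, hF, hFc⟩ := exists_cos_pi_mul_eq_on_ball hR (f := fun z => 2 * f z - 1)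
    ((hf.const_mul 2).sub_const 1) (fun z hz h => h1 z hz (by linear_combination h / 2))
    (fun z hz h => h0 z hz (by linear_combination h / 2))
  have hFint : ∀ z ∈ ball c R, ∀ n : ℤ, F z ≠ n := by
    intro z hz n hn
    have hcos := hF z hz
    rw [hn] at hcos
    rcases cos_pi_mul_int_eq_one_or n with h | h
    · exact h1 z hz (by linear_combination (h - hcos) / 2)
    · exact h0 z hz (by linear_combination (h - hcos) / 2)
  obtain ⟨G, hGd, hG, hGc⟩ := exists_cos_pi_mul_eq_on_ball hR hFd
    (fun z hz => by simpa using hFint z hz 1) (fun z hz => by simpa using hFint z hz (-1))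
  refine ⟨G, hGd, fun z hz => by rw [hG z hz, hF z hz], fun w hw => ?_, ?_⟩
  · obtain ⟨p, hp, n, hn⟩ := exists_mem_ball_cos_pi_mul_eq_int w
    obtain ⟨x, hx, rfl⟩ := hw hp
    exact hFint x hx n ((hG x hx).symm.trans hn)
  · have hnorm : ‖2 * f c - 1‖ ≤ 2 * ‖f c‖ + 1 := by
      simpa only [norm_mul, Complex.norm_ofNat, norm_one] using norm_sub_le (2 * f c) 1
    linarith

theorem norm_sub_le_of_forall_not_ball_subset_image {f : ℂ → ℂ} {c z : ℂ} {R : ℝ}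
    (hf : DifferentiableOn ℂ f (ball c R)) (hno : ∀ w, ¬ ball w 1 ⊆ f '' ball c R)
    (hz : z ∈ ball c (R / 2)) : ‖f z - f c‖ ≤ 72 := by
  have hR : 0 < R / 2 := pos_of_mem_ball hz
  have hderiv : ∀ x ∈ ball c (R / 2), ‖deriv f x‖ ≤ 72 / (R / 2) := by
    intro x hx
    have hsub : ball x (R / 2) ⊆ ball c R := ball_subset_ball' (by linarith [mem_ball.1 hx])
    rw [le_div_iff₀' hR]
    exact mul_norm_deriv_le_of_forall_not_ball_subset_image (hf.mono hsub)
      fun w hw => hno w (hw.trans (image_mono hsub))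
  calc ‖f z - f c‖ ≤ 72 / (R / 2) * ‖z - c‖ :=
        (convex_ball c (R / 2)).norm_image_sub_le_of_norm_deriv_le
          (fun x hx => hf.differentiableAt
            (isOpen_ball.mem_nhds (ball_subset_ball (by linarith) hx)))
          hderiv (mem_ball_self hR) hz
    _ ≤ 72 / (R / 2) * (R / 2) := by gcongr; exact (mem_ball_iff_norm.1 hz).le
    _ = 72 := div_mul_cancel₀ _ hR.ne'

theorem norm_cos_pi_mul_le (z : ℂ) : ‖Complex.cos (Real.pi * z)‖ ≤ Real.exp (Real.pi * ‖z‖) := by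
  have hnorm : ‖(Real.pi : ℂ) * z‖ = Real.pi * ‖z‖ := by
    rw [norm_mul, Complex.norm_real, Real.norm_of_nonneg Real.pi_pos.le]
  have hpos := Complex.norm_exp_le_exp_norm (Real.pi * z * Complex.I)
  have hneg := Complex.norm_exp_le_exp_norm (-(Real.pi * z) * Complex.I)
  rw [norm_mul, Complex.norm_I, mul_one, hnorm] at hpos
  rw [norm_mul, Complex.norm_I, mul_one, norm_neg, hnorm] at hneg
  rw [Complex.cos, norm_div, Complex.norm_ofNat]
  linarith [norm_add_le (Complex.exp (Real.pi * z * Complex.I))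
    (Complex.exp (-(Real.pi * z) * Complex.I))]

theorem exists_bound_of_schottky (A : ℝ) :
    ∃ C : ℝ, ∀ (f : ℂ → ℂ) (c : ℂ) (R : ℝ), DifferentiableOn ℂ f (ball c R) →
      (∀ z ∈ ball c R, f z ≠ 0) → (∀ z ∈ ball c R, f z ≠ 1) → ‖f c‖ ≤ A →
      ∀ z ∈ ball c (R / 2), ‖f z‖ ≤ C := by
  refine ⟨(Real.exp (Real.pi * Real.exp (Real.pi * (8 * A + 79))) + 1) / 2,
    fun f c R hf h0 h1 hA z hz => ?_⟩
  have hR : 0 < R / 2 := pos_of_mem_ball hz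
  obtain ⟨G, hGd, hG, hno, hGc⟩ := exists_double_arccos_on_ball (by linarith) hf h0 h1
  have hGz : ‖G z‖ ≤ 8 * A + 79 := by
    linarith [norm_le_insert' (G z) (G c), norm_sub_le_of_forall_not_ball_subset_image hGd hno hz]
  have hfz : ‖2 * f z - 1‖ ≤ Real.exp (Real.pi * Real.exp (Real.pi * (8 * A + 79))) := by
    rw [← hG z (ball_subset_ball (by linarith) hz)]
    refine (norm_cos_pi_mul_le _).trans ?_
    gcongr
    refine (norm_cos_pi_mul_le _).trans ?_
    gcongr
  rw [show f z = (2 * f z - 1 + 1) / 2 by ring, norm_div, Complex.norm_ofNat]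
  linarith [norm_add_le (2 * f z - 1) 1, norm_one (α := ℂ)]

/-! ### Normal families of holomorphic functions -/

theorem exists_forall_norm_le_of_eventually {α E : Type*} [TopologicalSpace α]
    [SeminormedAddCommGroup E] {u : ℕ → α → E} {p : α} (hu : ∀ k, ContinuousAt (u k) p)
    (hb : ∃ N ∈ 𝓝 p, ∃ M : ℝ, ∀ᶠ k in atTop, ∀ x ∈ N, ‖u k x‖ ≤ M) :
    ∃ N ∈ 𝓝 p, ∃ M : ℝ, ∀ k, ∀ x ∈ N, ‖u k x‖ ≤ M := by
  obtain ⟨N, hN, M, hM⟩ := hb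
  obtain ⟨k₀, hk₀⟩ := eventually_atTop.1 hM
  have hinit : ∀ᶠ x in 𝓝 p, ∀ k ∈ Finset.range k₀, ‖u k x‖ ≤ ‖u k p‖ + 1 :=
    (eventually_all_finset _).2 fun k _ =>
      (((hu k).norm.eventually_lt continuousAt_const (lt_add_one ‖u k p‖))).mono fun _ => le_of_lt
  refine ⟨_, inter_mem hN hinit, max M (∑ k ∈ Finset.range k₀, (‖u k p‖ + 1)), fun k x hx => ?_⟩
  rcases le_or_gt k₀ k with hk | hk
  · exact le_max_of_le_left (hk₀ k hk x hx.1)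
  · refine le_max_of_le_right ((hx.2 k (Finset.mem_range.2 hk)).trans ?_)
    exact Finset.single_le_sum (f := fun k => ‖u k p‖ + 1) (fun i _ => by positivity)
      (Finset.mem_range.2 hk)

theorem equicontinuous_domRestrict_of_locally_bounded {ι : Type*} {X : Set ℂ} (hX : IsOpen X)
    {u : ι → ℂ → ℂ} (hu : ∀ i, DifferentiableOn ℂ (u i) X)
    (hb : ∀ p ∈ X, ∃ N ∈ 𝓝 p, ∃ M : ℝ, ∀ i, ∀ x ∈ N, ‖u i x‖ ≤ M) :
    Equicontinuous fun i => X.domRestrict (u i) := by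
  rintro ⟨p, hp⟩
  obtain ⟨N, hN, M, hM⟩ := hb p hp
  obtain ⟨r, hr, hball⟩ := Metric.mem_nhds_iff.1 (inter_mem hN (hX.mem_nhds hp))
  have hcont : Continuous fun x : X => 2 * M / r * dist (x : ℂ) p := by fun_prop
  refine Metric.equicontinuousAt_of_continuity_modulus _
    (by simpa using hcont.tendsto ⟨p, hp⟩) _ ?_
  filter_upwards [continuous_subtype_val.continuousAt.eventually (ball_mem_nhds p hr)] with x hx i
  rw [dist_comm]
  refine Complex.dist_le_div_mul_dist_of_mapsTo_ball
    ((hu i).mono fun y hy => (hball hy).2) (fun y hy => ?_) hx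
  rw [mem_closedBall, dist_eq_norm]
  linarith [hM i y (hball hy).1, hM i p (mem_of_mem_nhds hN), norm_sub_le (u i y) (u i p)]

theorem isCompact_closure_range_of_equicontinuous {ι X E : Type*} [TopologicalSpace X]
    [LocallyCompactSpace X] [UniformSpace E] [T2Space E] [CompleteSpace E] {v : ι → C(X, E)}
    (hequi : Equicontinuous fun i => ⇑(v i)) (hbdd : ∀ x, ∃ K, IsCompact K ∧ ∀ i, v i x ∈ K) :
    IsCompact (closure (range v)) := by
  have : T2Space (UniformOnFun X E {K : Set X | IsCompact K}) :=
    UniformOnFun.t2Space_of_covering (eq_univ_of_forall fun x =>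
      mem_sUnion_of_mem (mem_singleton x) isCompact_singleton)
  refine ArzelaAscoli.isCompact_closure_of_isClosedEmbedding (𝔖 := {K : Set X | IsCompact K})
    (F := fun w : C(X, E) => (w : X → E)) (fun K hK => hK)
    ContinuousMap.isUniformEmbedding_toUniformOnFunIsCompact.isClosedEmbedding
    (fun K _ => Equicontinuous.equicontinuousOn ?_ K) fun K _ x _ => ?_
  · intro x U hU
    filter_upwards [hequi x U hU] with y hy
    rintro ⟨_, i, rfl⟩
    exact hy i
  · obtain ⟨L, hL, hvL⟩ := hbdd x
    refine ⟨L, hL, ?_⟩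
    rintro _ ⟨i, rfl⟩
    exact hvL i

theorem exists_subseq_tendstoLocallyUniformlyOn_of_montel {X : Set ℂ} (hX : IsOpen X)
    {u : ℕ → ℂ → ℂ} (hu : ∀ k, DifferentiableOn ℂ (u k) X)
    (hb : ∀ p ∈ X, ∃ N ∈ 𝓝 p, ∃ M : ℝ, ∀ᶠ k in atTop, ∀ x ∈ N, ‖u k x‖ ≤ M) :
    ∃ φ : ℕ → ℕ, StrictMono φ ∧ ∃ h : ℂ → ℂ,
      TendstoLocallyUniformlyOn (fun k => u (φ k)) h atTop X := by
  classical
  have : LocallyCompactSpace X := hX.locallyCompactSpace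
  have hb' : ∀ p ∈ X, ∃ N ∈ 𝓝 p, ∃ M : ℝ, ∀ k, ∀ x ∈ N, ‖u k x‖ ≤ M := fun p hp =>
    exists_forall_norm_le_of_eventually
      (fun k => (hu k).continuousOn.continuousAt (hX.mem_nhds hp)) (hb p hp)
  let v : ℕ → C(X, ℂ) := fun k =>
    ⟨X.domRestrict (u k), continuousOn_iff_continuous_domRestrict.1 (hu k).continuousOn⟩
  have hcompact : IsCompact (closure (range v)) := by
    refine isCompact_closure_range_of_equicontinuous
      (equicontinuous_domRestrict_of_locally_bounded hX hu hb') fun x => ?_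
    obtain ⟨N, hN, M, hM⟩ := hb' x x.2
    exact ⟨closedBall 0 M, isCompact_closedBall _ _, fun k =>
      mem_closedBall_zero_iff.2 (hM k x (mem_of_mem_nhds hN))⟩
  obtain ⟨h, -, φ, hφ, hlim⟩ :=
    hcompact.tendsto_subseq fun k => subset_closure (mem_range_self k)
  refine ⟨φ, hφ, fun z => if hz : z ∈ X then h ⟨z, hz⟩ else 0, ?_⟩
  rw [ContinuousMap.tendsto_iff_tendstoLocallyUniformly] at hlim
  rw [tendstoLocallyUniformlyOn_iff_tendstoLocallyUniformly_comp_coe]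
  have hext : (fun z => if hz : z ∈ X then h ⟨z, hz⟩ else 0) ∘ ((↑) : X → ℂ) = h :=
    funext fun z => dif_pos z.2
  rw [hext]
  exact hlim

/-! ### Hurwitz's theorem -/

theorem exists_closedBall_subset_sphere_le {h : ℂ → ℂ} {z : ℂ} (hh : AnalyticAt ℂ h z)
    (hne : ¬ ∀ᶠ x in 𝓝 z, h x = h z) {s : Set ℂ} (hs : s ∈ 𝓝 z) :
    ∃ r > 0, closedBall z r ⊆ s ∧ ∃ ε > 0, ∀ x ∈ sphere z r, ε ≤ ‖h x - h z‖ := by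
  have hiso : ∀ᶠ x in 𝓝[≠] z, h x ≠ h z :=
    (hh.eventually_eq_or_eventually_ne analyticAt_const).resolve_left hne
  rw [eventually_nhdsWithin_iff] at hiso
  obtain ⟨r, hr, hball⟩ := nhds_basis_closedBall.mem_iff.1
    (inter_mem hs (hiso.and (hh.eventually_continuousAt)))
  have hcont : ContinuousOn (fun x => ‖h x - h z‖) (sphere z r) := fun x hx =>
    ((hball (sphere_subset_closedBall hx)).2.2.sub
      continuousAt_const).norm.continuousWithinAt
  obtain ⟨y, hy, hmin⟩ := (isCompact_sphere z r).exists_isMinOn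
    (NormedSpace.sphere_nonempty.2 hr.le) hcont
  refine ⟨r, hr, fun x hx => (hball hx).1, ‖h y - h z‖, ?_, fun x hx => hmin hx⟩
  exact norm_pos_iff.2 (sub_ne_zero.2
    ((hball (sphere_subset_closedBall hy)).2.1 (ne_of_mem_sphere hy hr.ne')))

theorem exists_ball_subset_image_of_hurwitz {X : Set ℂ} (hX : IsOpen X) {u : ℕ → ℂ → ℂ}
    {h : ℂ → ℂ} (hu : ∀ k, DifferentiableOn ℂ (u k) X)
    (hlim : TendstoLocallyUniformlyOn u h atTop X) {z : ℂ} (hz : z ∈ X)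
    (hne : ¬ ∀ᶠ x in 𝓝 z, h x = h z) {s : Set ℂ} (hs : s ∈ 𝓝 z) :
    ∃ ε > 0, ∀ᶠ k in atTop, ball (h z) ε ⊆ u k '' s := by
  have hh : AnalyticAt ℂ h z :=
    (hlim.differentiableOn (.of_forall hu) hX).analyticAt (hX.mem_nhds hz)
  obtain ⟨r, hr, hball, ε, hε, hmin⟩ :=
    exists_closedBall_subset_sphere_le hh hne (inter_mem hs (hX.mem_nhds hz))
  have hunif := (tendstoLocallyUniformlyOn_iff_forall_isCompact hX).1 hlim _
    (hball.trans inter_subset_right) (isCompact_closedBall z r)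
  refine ⟨ε / 8, by positivity, ?_⟩
  filter_upwards [Metric.tendstoUniformlyOn_iff.1 hunif (ε / 8) (by positivity)] with k hk
  have hkz := hk z (mem_closedBall_self hr.le)
  have hsphere : ∀ x ∈ sphere z r, ε / 2 ≤ ‖u k x - u k z‖ := by
    intro x hx
    rw [← dist_eq_norm]
    linarith [hk x (sphere_subset_closedBall hx), dist_comm (h z) (u k z),
      (hmin x hx).trans_eq (dist_eq_norm (h x) (h z)).symm,
      dist_triangle4 (h x) (u k x) (u k z) (h z)]
  have himage := ball_subset_image_closedBall_of_le_norm_sub hr (half_pos hε)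
    ((hu k).mono (closure_ball_subset_closedBall.trans
      (hball.trans inter_subset_right))).diffContOnCl hsphere
  refine (ball_subset_ball' ?_).trans
    (himage.trans (image_mono (hball.trans inter_subset_left)))
  linarith

/-! ### Entire functions -/

theorem exists_eq_add_mul_of_linear_growth {v : ℂ → ℂ} (hv : Differentiable ℂ v) {c : ℂ} {C : ℝ}
    (hC : 0 ≤ C) (hb : ∀ z, 1 ≤ ‖z - c‖ → ‖v z‖ ≤ C * ‖z - c‖) :
    ∃ k : ℂ, ∀ z, v z = v c + k * (z - c) := by
  have hderiv_le : ∀ x, ‖deriv v x‖ ≤ 2 * C := by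
    intro x
    have hsphere : ∀ z ∈ sphere x (‖x - c‖ + 1), ‖v z‖ ≤ C * (2 * (‖x - c‖ + 1)) := by
      intro z hz
      rw [mem_sphere_iff_norm] at hz
      have hupper := norm_sub_le_norm_sub_add_norm_sub z x c
      have hlower := norm_sub_le (z - c) (x - c)
      rw [sub_sub_sub_cancel_right] at hlower
      exact (hb z (by linarith)).trans (mul_le_mul_of_nonneg_left (by linarith) hC)
    refine (Complex.norm_deriv_le_of_forall_mem_sphere_norm_le (by positivity)
      hv.diffContOnCl hsphere).trans_eq ?_
    field_simp
  have hderiv : ∀ x, deriv v x = deriv v c := fun x =>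
    hv.deriv.apply_eq_apply_of_bounded (isBounded_iff_forall_norm_le.2
      ⟨2 * C, forall_mem_range.2 hderiv_le⟩) x c
  have hconst : ∀ x, HasDerivAt (fun z => v z - deriv v c * z) 0 x := by
    intro x
    simpa [hderiv x] using (hv x).hasDerivAt.fun_sub ((hasDerivAt_id x).const_mul (deriv v c))
  refine ⟨deriv v c, fun z => ?_⟩
  linear_combination is_const_of_deriv_eq_zero (fun x => (hconst x).differentiableAt)
    (fun x => (hconst x).deriv) z c

theorem dslope_ne_zero_of_injective {f : ℂ → ℂ} (hinj : Function.Injective f) {c : ℂ}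
    (hc : deriv f c ≠ 0) (z : ℂ) : dslope f c z ≠ 0 := by
  rcases eq_or_ne z c with rfl | hz
  · rwa [dslope_same]
  · rw [dslope_of_ne f hz, slope_def_field]
    exact div_ne_zero (sub_ne_zero.2 (hinj.ne hz)) (sub_ne_zero.2 hz)

theorem exists_le_norm_sub_of_injective {f : ℂ → ℂ} (hf : Differentiable ℂ f)
    (hinj : Function.Injective f) {c : ℂ} (hc : deriv f c ≠ 0) :
    ∃ ε > 0, ∀ z, 1 ≤ ‖z - c‖ → ε ≤ ‖f z - f c‖ := by
  have hopen : f '' ball c 1 ∈ 𝓝 (f c) := by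
    rw [← (hf.analyticAt c).hasStrictDerivAt.map_nhds_eq hc]
    exact image_mem_map (ball_mem_nhds c one_pos)
  obtain ⟨ε, hε, hball⟩ := Metric.mem_nhds_iff.1 hopen
  refine ⟨ε, hε, fun z hz => ?_⟩
  by_contra! hlt
  obtain ⟨x, hx, hxz⟩ := hball (mem_ball_iff_norm.2 hlt)
  rw [hinj hxz, mem_ball_iff_norm] at hx
  exact hx.not_ge hz

theorem exists_eq_mul_add_of_injective {f : ℂ → ℂ} (hf : Differentiable ℂ f)
    (hinj : Function.Injective f) : ∃ α β : ℂ, ∀ z, f z = α * z + β := by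
  obtain ⟨c, hc⟩ : ∃ c, deriv f c ≠ 0 := by
    by_contra! h
    exact zero_ne_one (hinj (is_const_of_deriv_eq_zero hf h 0 1))
  have hne := dslope_ne_zero_of_injective hinj hc
  have hdslope : Differentiable ℂ (dslope f c) := fun x =>
    ((Complex.differentiableOn_dslope univ_mem).2 hf.differentiableOn).differentiableAt univ_mem
  obtain ⟨ε, hε, hfar⟩ := exists_le_norm_sub_of_injective hf hinj hc
  obtain ⟨k, hk⟩ : ∃ k : ℂ, ∀ z, (dslope f c z)⁻¹ = (dslope f c c)⁻¹ + k * (z - c) := by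
    refine exists_eq_add_mul_of_linear_growth (hdslope.inv hne) (C := 1 / ε) (by positivity)
      fun z hz => ?_
    have hzc : z ≠ c := by
      rintro rfl
      norm_num at hz
    rw [Pi.inv_apply, dslope_of_ne f hzc, slope_def_field, inv_div, norm_div, one_div_mul_eq_div]
    gcongr
    exact hfar z hz
  -- The affine function `1 / dslope f c` has no zero, so it is constant.
  have hk0 : k = 0 := by
    by_contra hk0
    refine inv_ne_zero (hne (c - (dslope f c c)⁻¹ / k)) ((hk _).trans ?_)
    field_simp
    ring
  refine ⟨deriv f c, f c - deriv f c * c, fun z => ?_⟩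
  have hslope := sub_smul_dslope f c z
  have hz := hk z
  rw [hk0, zero_mul, add_zero, inv_inj, dslope_same] at hz
  rw [hz, smul_eq_mul] at hslope
  linear_combination -hslope

/-! ### Normality in the spherical metric -/

section LocallyUniformConvergence

variable {α β γ ι : Type*} [TopologicalSpace α] [UniformSpace β] [UniformSpace γ]
  {l : Filter ι} {F : ι → α → β} {h : α → β} {V : Set α}

theorem tendsto_prod_nhds_of_tendstoLocallyUniformlyOn (hlim : TendstoLocallyUniformlyOn F h l V)
    (hV : IsOpen V) (hc : ContinuousOn h V) {x : α} (hx : x ∈ V) :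
    Tendsto (fun p : ι × α => F p.1 p.2) (l ×ˢ 𝓝 x) (𝓝 (h x)) := by
  have hunif := tendstoLocallyUniformlyOn_iff_forall_tendsto.1 hlim x hx
  rw [hV.nhdsWithin_eq hx] at hunif
  have hcont : Tendsto (fun p : ι × α => h p.2) (l ×ˢ 𝓝 x) (𝓝 (h x)) :=
    (hc.continuousAt (hV.mem_nhds hx)).tendsto.comp tendsto_snd
  exact Uniform.tendsto_nhds_right.2
    ((Uniform.tendsto_nhds_right.1 hcont).uniformity_trans hunif)

theorem tendstoLocallyUniformlyOn_of_tendsto_prod_nhds (hV : IsOpen V) (hc : ContinuousOn h V)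
    (hlim : ∀ x ∈ V, Tendsto (fun p : ι × α => F p.1 p.2) (l ×ˢ 𝓝 x) (𝓝 (h x))) :
    TendstoLocallyUniformlyOn F h l V := by
  rw [tendstoLocallyUniformlyOn_iff_forall_tendsto]
  intro x hx
  rw [hV.nhdsWithin_eq hx]
  have hcont : Tendsto (fun p : ι × α => h p.2) (l ×ˢ 𝓝 x) (𝓝 (h x)) :=
    (hc.continuousAt (hV.mem_nhds hx)).tendsto.comp tendsto_snd
  exact (hcont.prodMk_nhds (hlim x hx)).mono_right (nhds_le_uniformity (h x))

theorem tendstoLocallyUniformlyOn_comp_of_continuousAt (hlim : TendstoLocallyUniformlyOn F h l V)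
    (hV : IsOpen V) (hc : ContinuousOn h V) {J : α → β → γ}
    (hJ : ∀ x ∈ V, ContinuousAt (fun p : α × β => J p.1 p.2) (x, h x)) :
    TendstoLocallyUniformlyOn (fun k x => J x (F k x)) (fun x => J x (h x)) l V := by
  refine tendstoLocallyUniformlyOn_of_tendsto_prod_nhds hV (fun x hx => ?_) fun x hx => ?_
  · have hpair : ContinuousAt (fun y => (y, h y)) x :=
      continuousAt_id.prodMk (hc.continuousAt (hV.mem_nhds hx))
    exact (ContinuousAt.comp (f := fun y => (y, h y)) (hJ x hx) hpair).continuousWithinAt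
  · exact (hJ x hx).tendsto.comp (tendsto_snd.prodMk_nhds
      (tendsto_prod_nhds_of_tendstoLocallyUniformlyOn hlim hV hc hx))

end LocallyUniformConvergence

theorem tendsto_coe_sphere_cobounded :
    Tendsto ((↑) : ℂ → Sphere) (Bornology.cobounded ℂ) (𝓝 OnePoint.infty) := by
  rw [cobounded_eq_cocompact, ← coclosedCompact_eq_cocompact]
  exact OnePoint.tendsto_coe_infty

theorem continuous_add_inv_sphere (a : ℂ) :
    Continuous fun v : ℂ => if v = 0 then OnePoint.infty else ((a + v⁻¹ : ℂ) : Sphere) := by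
  rw [continuous_iff_continuousAt]
  intro v
  rcases eq_or_ne v 0 with rfl | hv
  · rw [continuousAt_iff_punctured_nhds, if_pos rfl]
    refine (tendsto_coe_sphere_cobounded.comp
      (((tendsto_const_add_cobounded a).comp tendsto_inv₀_nhdsNE_zero))).congr' ?_
    filter_upwards [self_mem_nhdsWithin] with x hx
    exact (if_neg hx).symm
  · have hcont : ContinuousAt (fun v : ℂ => ((a + v⁻¹ : ℂ) : Sphere)) v :=
      OnePoint.continuous_coe.continuousAt.comp
        (continuousAt_const.add (continuousAt_inv₀ hv))
    refine hcont.congr ?_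
    filter_upwards [isOpen_ne.mem_nhds hv] with x hx
    exact (if_neg hx).symm

theorem exists_subseq_tendstoLocallyUniformlyOn_of_ne_zero_of_ne_one {v : ℕ → ℂ → ℂ} {c : ℂ}
    {R A : ℝ} (hv : ∀ k, DifferentiableOn ℂ (v k) (ball c R)) (h0 : ∀ k, ∀ z ∈ ball c R, v k z ≠ 0)
    (h1 : ∀ k, ∀ z ∈ ball c R, v k z ≠ 1) (hA : ∃ᶠ k in atTop, ‖v k c‖ ≤ A) :
    ∃ φ : ℕ → ℕ, StrictMono φ ∧ ∃ h : ℂ → ℂ,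
      TendstoLocallyUniformlyOn (fun k => v (φ k)) h atTop (ball c (R / 2)) := by
  have hsub : ball c (R / 2) ⊆ ball c R := fun z hz =>
    ball_subset_ball (by linarith [pos_of_mem_ball hz]) hz
  obtain ⟨C, hC⟩ := exists_bound_of_schottky A
  obtain ⟨ψ, hψ, hψA⟩ := extraction_of_frequently_atTop hA
  obtain ⟨φ, hφ, h, hlim⟩ := exists_subseq_tendstoLocallyUniformlyOn_of_montel isOpen_ball
    (u := fun k => v (ψ k)) (fun k => (hv (ψ k)).mono hsub) fun p hp =>
      ⟨ball c (R / 2), isOpen_ball.mem_nhds hp, C, .of_forall fun k =>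
        hC _ c R (hv _) (h0 _) (h1 _) (hψA k)⟩
  exact ⟨ψ ∘ φ, hψ.comp hφ, h, hlim⟩

section OmittedValues

variable {u : ℕ → ℂ → ℂ} {b : ℂ → ℂ} {a c : ℂ} {R : ℝ}

theorem exists_subseq_of_omits_of_frequently_le
    (hu : ∀ k, DifferentiableOn ℂ (u k) (ball c R)) (hb : DifferentiableOn ℂ b (ball c R))
    (hba : ∀ z ∈ ball c R, b z ≠ a) (hua : ∀ k, ∀ z ∈ ball c R, u k z ≠ a)
    (hub : ∀ k, ∀ z ∈ ball c R, u k z ≠ b z) (hle : ∃ᶠ k in atTop, ‖u k c - a‖ ≤ ‖b c - a‖) :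
    ∃ φ : ℕ → ℕ, StrictMono φ ∧ ∃ H : ℂ → Sphere,
      TendstoLocallyUniformlyOn (fun k z => ((u (φ k) z : ℂ) : Sphere)) H atTop
        (ball c (R / 2)) := by
  have hsub : ball c (R / 2) ⊆ ball c R := fun z hz =>
    ball_subset_ball (by linarith [pos_of_mem_ball hz]) hz
  have hba' : ∀ z ∈ ball c R, b z - a ≠ 0 := fun z hz => sub_ne_zero.2 (hba z hz)
  have hv : ∀ k, DifferentiableOn ℂ (fun z => (u k z - a) / (b z - a)) (ball c R) := fun k =>
    ((hu k).sub_const a).div (hb.sub_const a) hba'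
  obtain ⟨φ, hφ, h, hlim⟩ := exists_subseq_tendstoLocallyUniformlyOn_of_ne_zero_of_ne_one hv
    (fun k z hz => div_ne_zero (sub_ne_zero.2 (hua k z hz)) (hba' z hz))
    (fun k z hz h1 => hub k z hz (sub_left_injective ((div_eq_one_iff_eq (hba' z hz)).1 h1)))
    (hle.mono fun k hk => (norm_div _ _).trans_le (div_le_one_of_le₀ hk (norm_nonneg _)))
  have hc : ContinuousOn h (ball c (R / 2)) :=
    hlim.continuousOn (.of_forall fun k => ((hv _).mono hsub).continuousOn)
  refine ⟨φ, hφ, _, (tendstoLocallyUniformlyOn_comp_of_continuousAt hlim isOpen_ball hc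
    (J := fun z v => ((a + (b z - a) * v : ℂ) : Sphere)) fun z hz => ?_).congr fun k z hz => ?_⟩
  · have hbz : ContinuousAt (fun p : ℂ × ℂ => b p.1) (z, h z) :=
      ContinuousAt.comp (f := Prod.fst)
        (hb.continuousOn.continuousAt (isOpen_ball.mem_nhds (hsub hz))) continuousAt_fst
    exact OnePoint.continuous_coe.continuousAt.comp
      (continuousAt_const.add ((hbz.sub continuousAt_const).mul continuousAt_snd))
  · simp only [mul_div_cancel₀ _ (hba' z (hsub hz)), add_sub_cancel]

theorem exists_subseq_of_omits_of_frequently_ge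
    (hu : ∀ k, DifferentiableOn ℂ (u k) (ball c R)) (hb : DifferentiableOn ℂ b (ball c R))
    (hba : ∀ z ∈ ball c R, b z ≠ a) (hua : ∀ k, ∀ z ∈ ball c R, u k z ≠ a)
    (hub : ∀ k, ∀ z ∈ ball c R, u k z ≠ b z) (hge : ∃ᶠ k in atTop, ‖b c - a‖ ≤ ‖u k c - a‖) :
    ∃ φ : ℕ → ℕ, StrictMono φ ∧ ∃ H : ℂ → Sphere,
      TendstoLocallyUniformlyOn (fun k z => ((u (φ k) z : ℂ) : Sphere)) H atTop
        (ball c (R / 2)) := by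
  have hsub : ball c (R / 2) ⊆ ball c R := fun z hz =>
    ball_subset_ball (by linarith [pos_of_mem_ball hz]) hz
  have hba' : ∀ z ∈ ball c R, b z - a ≠ 0 := fun z hz => sub_ne_zero.2 (hba z hz)
  have hua' : ∀ k, ∀ z ∈ ball c R, u k z - a ≠ 0 := fun k z hz => sub_ne_zero.2 (hua k z hz)
  have hv : ∀ k, DifferentiableOn ℂ (fun z => (b z - a) / (u k z - a)) (ball c R) := fun k =>
    (hb.sub_const a).div ((hu k).sub_const a) (hua' k)
  obtain ⟨φ, hφ, h, hlim⟩ := exists_subseq_tendstoLocallyUniformlyOn_of_ne_zero_of_ne_one hv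
    (fun k z hz => div_ne_zero (hba' z hz) (hua' k z hz))
    (fun k z hz h1 => hub k z hz
      (sub_left_injective ((div_eq_one_iff_eq (hua' k z hz)).1 h1)).symm)
    (hge.mono fun k hk => (norm_div _ _).trans_le (div_le_one_of_le₀ hk (norm_nonneg _)))
  have hc : ContinuousOn h (ball c (R / 2)) :=
    hlim.continuousOn (.of_forall fun k => ((hv _).mono hsub).continuousOn)
  refine ⟨φ, hφ, _, (tendstoLocallyUniformlyOn_comp_of_continuousAt hlim isOpen_ball hc
    (J := fun z v => if v / (b z - a) = 0 then OnePoint.infty else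
      ((a + (v / (b z - a))⁻¹ : ℂ) : Sphere)) fun z hz => ?_).congr fun k z hz => ?_⟩
  · have hbz : ContinuousAt (fun p : ℂ × ℂ => b p.1) (z, h z) :=
      ContinuousAt.comp (f := Prod.fst)
        (hb.continuousOn.continuousAt (isOpen_ball.mem_nhds (hsub hz))) continuousAt_fst
    exact (continuous_add_inv_sphere a).continuousAt.comp
      (f := fun p : ℂ × ℂ => p.2 / (b p.1 - a))
      (continuousAt_snd.div (hbz.sub continuousAt_const) (hba' z (hsub hz)))
  · have hquot : (b z - a) / (u (φ k) z - a) / (b z - a) = (u (φ k) z - a)⁻¹ := by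
      rw [div_div_cancel_left' (hba' z (hsub hz))]
    simp only [hquot, inv_inv, add_sub_cancel, if_neg (inv_ne_zero (hua' (φ k) z (hsub hz)))]

theorem exists_subseq_tendstoLocallyUniformlyOn_of_omits
    (hu : ∀ k, DifferentiableOn ℂ (u k) (ball c R)) (hb : DifferentiableOn ℂ b (ball c R))
    (hba : ∀ z ∈ ball c R, b z ≠ a) (hua : ∀ k, ∀ z ∈ ball c R, u k z ≠ a)
    (hub : ∀ k, ∀ z ∈ ball c R, u k z ≠ b z) :
    ∃ φ : ℕ → ℕ, StrictMono φ ∧ ∃ H : ℂ → Sphere,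
      TendstoLocallyUniformlyOn (fun k z => ((u (φ k) z : ℂ) : Sphere)) H atTop
        (ball c (R / 2)) := by
  by_cases hle : ∃ᶠ k in atTop, ‖u k c - a‖ ≤ ‖b c - a‖
  · exact exists_subseq_of_omits_of_frequently_le hu hb hba hua hub hle
  · refine exists_subseq_of_omits_of_frequently_ge hu hb hba hua hub ?_
    exact (not_frequently.1 hle).frequently.mono fun k hk => (not_le.1 hk).le

end OmittedValues

/-! ### Meromorphic functions and their Fatou sets -/

/-- The point of `ℂ` underlying a finite point of the sphere, with the junk value `0` at `∞`. -/
noncomputable def finitePart (w : Sphere) : ℂ := w.elim 0 id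

@[simp] theorem finitePart_coe (z : ℂ) : finitePart (z : Sphere) = z := rfl

theorem coe_finitePart {w : Sphere} (hw : w ≠ OnePoint.infty) : (finitePart w : Sphere) = w := by
  obtain ⟨z, rfl⟩ := OnePoint.ne_infty_iff_exists.1 hw
  rfl

theorem continuousAt_finitePart {w : Sphere} (hw : w ≠ OnePoint.infty) :
    ContinuousAt finitePart w := by
  obtain ⟨z, rfl⟩ := OnePoint.ne_infty_iff_exists.1 hw
  rw [OnePoint.continuousAt_coe]
  exact continuousAt_id

@[simp] theorem sphereExt_coe (f : ℂ → Sphere) (z : ℂ) : sphereExt f (z : Sphere) = f z := rfl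

theorem iter_succ (f : ℂ → Sphere) (n : ℕ) (z : ℂ) :
    iter f (n + 1) z = sphereExt f (iter f n z) :=
  Function.iterate_succ_apply' _ _ _

namespace IsMeromorphicFun

variable {f : ℂ → Sphere}

theorem analyticAt_finitePart (hf : IsMeromorphicFun f) {z : ℂ} (hz : f z ≠ OnePoint.infty) :
    AnalyticAt ℂ (fun x => finitePart (f x)) z := by
  obtain ⟨hc, G, hG, hfG⟩ := hf
  refine MeromorphicAt.analyticAt ((hG z).congr ?_)
    (ContinuousAt.comp (continuousAt_finitePart hz) hc.continuousAt)
  filter_upwards [hfG z] with x hx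
  rw [hx, finitePart_coe]

theorem eventually_eq_or_eventually_ne (hf : IsMeromorphicFun f) (c x : ℂ) :
    (∀ᶠ y in 𝓝[≠] x, f y = c) ∨ ∀ᶠ y in 𝓝[≠] x, f y ≠ c := by
  obtain ⟨-, G, hG, hfG⟩ := hf
  refine ((hG x).sub (.const c x)).eventually_eq_zero_or_eventually_ne_zero.imp ?_ ?_ <;>
  · intro h
    filter_upwards [h, hfG x] with y hy hfy
    simpa [hfy, sub_eq_zero] using hy

theorem eq_const_of_eventually_eq (hf : IsMeromorphicFun f) {z c : ℂ}
    (hz : ∀ᶠ y in 𝓝[≠] z, f y = c) (x : ℂ) : f x = c := by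
  have hclopen : IsClopen {x | ∀ᶠ y in 𝓝[≠] x, f y = c} := by
    refine ⟨?_, isOpen_setOfPred_eventually_nhdsWithin⟩
    have hcompl : {x | ∀ᶠ y in 𝓝[≠] x, f y = c}ᶜ = {x | ∀ᶠ y in 𝓝[≠] x, f y ≠ c} := by
      ext x
      refine ⟨(hf.eventually_eq_or_eventually_ne c x).resolve_left, fun hne heq => ?_⟩
      obtain ⟨y, hy, hy'⟩ := ((mem_ofPred.1 heq).and (mem_ofPred.1 hne)).exists
      exact hy' hy
    rw [← isOpen_compl_iff, hcompl]
    exact isOpen_setOfPred_eventually_nhdsWithin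
  have hx : ∀ᶠ y in 𝓝[≠] x, f y = c := eq_univ_iff_forall.1 (hclopen.eq_univ ⟨z, hz⟩) x
  exact tendsto_nhds_unique (hf.1.continuousAt.tendsto.mono_left nhdsWithin_le_nhds)
    (tendsto_const_nhds.congr' (hx.mono fun y hy => hy.symm))

theorem nhds_le_map (hf : IsMeromorphicFun f) (hne : ¬ ∃ c : Sphere, ∀ z, f z = c) {z : ℂ}
    (hz : f z ≠ OnePoint.infty) :
    𝓝 (finitePart (f z)) ≤ map (fun x => finitePart (f x)) (𝓝 z) := by
  refine (hf.analyticAt_finitePart hz).eventually_constant_or_nhds_le_map_nhds.resolve_left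
    fun hconst => hne ⟨_, hf.eq_const_of_eventually_eq (z := z) (c := finitePart (f z)) ?_⟩
  refine Eventually.filter_mono nhdsWithin_le_nhds ?_
  filter_upwards [hconst, hf.1.continuousAt.eventually_ne hz] with x hx hfx
  rw [← hx, coe_finitePart hfx]

end IsMeromorphicFun

theorem isOpen_fatouSet (f : ℂ → Sphere) : IsOpen (fatouSet f) := by
  rw [isOpen_iff_mem_nhds]
  rintro z ⟨V, hV, hz, h⟩
  filter_upwards [hV.mem_nhds hz] with x hx
  exact ⟨V, hV, hx, h⟩

section NormalityCriteria

variable {f : ℂ → Sphere} {V : Set ℂ} {w : ℂ} {u : ℕ → ℂ → ℂ}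

theorem mem_fatouSet_of_exists_subseq (hV : IsOpen V) (hw : w ∈ V)
    (hiter : ∀ n, ∀ z ∈ V, iter f n z = (u n z : Sphere)) (m : ℕ)
    (hsubseq : ∀ s : ℕ → ℕ, (∀ k, m ≤ s k) → ∃ φ : ℕ → ℕ, StrictMono φ ∧ ∃ h : ℂ → Sphere,
      TendstoLocallyUniformlyOn (fun k z => ((u (s (φ k)) z : ℂ) : Sphere)) h atTop V) :
    w ∈ fatouSet f := by
  refine ⟨V, hV, hw, fun z hz n m _ => ?_, fun s => ?_⟩
  · rw [hiter m z hz]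
    exact OnePoint.coe_ne_infty _
  by_cases hs : Tendsto s atTop atTop
  · obtain ⟨k₀, hk₀⟩ := eventually_atTop.1 (hs.eventually_ge_atTop m)
    obtain ⟨φ, hφ, h, hlim⟩ := hsubseq (fun k => s (k + k₀)) fun k => hk₀ _ (Nat.le_add_left _ _)
    exact ⟨fun k => φ k + k₀, hφ.add_const k₀, h, hlim.congr fun k z hz => (hiter _ z hz).symm⟩
  · obtain ⟨i, hi⟩ : ∃ i, ∃ᶠ k in atTop, s k = i := by
      rw [← Nat.cofinite_eq_atTop, Tendsto, le_cofinite_iff_eventually_ne] at hs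
      push Not at hs
      simpa only [Nat.cofinite_eq_atTop, Filter.Frequently, eventually_map] using hs
    obtain ⟨φ, hφ, hφi⟩ := extraction_of_frequently_atTop hi
    refine ⟨φ, hφ, iter f i, ?_⟩
    simp only [hφi]
    exact fun _ hW _ _ => ⟨V, self_mem_nhdsWithin, .of_forall fun _ _ _ => refl_mem_uniformity hW⟩

theorem mem_fatouSet_of_omits (hV : V ∈ 𝓝 w)
    (hiter : ∀ n, ∀ z ∈ V, iter f n z = (u n z : Sphere)) (hu : ∀ n, DifferentiableOn ℂ (u n) V)
    {a b : ℂ} (hab : a ≠ b) (ha : ∀ n, ∀ z ∈ V, u n z ≠ a) (hb : ∀ n, ∀ z ∈ V, u n z ≠ b) :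
    w ∈ fatouSet f := by
  obtain ⟨R, hR, hball⟩ := Metric.mem_nhds_iff.1 hV
  have hsub : ball w (R / 2) ⊆ V := (ball_subset_ball (half_le_self hR.le)).trans hball
  exact mem_fatouSet_of_exists_subseq isOpen_ball (mem_ball_self (half_pos hR))
    (fun n z hz => hiter n z (hsub hz)) 0 fun s _ =>
      exists_subseq_tendstoLocallyUniformlyOn_of_omits (fun k => (hu (s k)).mono hball)
        (differentiableOn_const b) (fun _ _ => hab.symm) (fun k z hz => ha _ z (hball hz))
        fun k z hz => hb _ z (hball hz)

theorem mem_fatouSet_of_bounded (hV : IsOpen V) (hw : w ∈ V)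
    (hiter : ∀ n, ∀ z ∈ V, iter f n z = (u n z : Sphere)) (hu : ∀ n, DifferentiableOn ℂ (u n) V)
    {M : ℝ} (hM : ∀ n, ∀ z ∈ V, ‖u n z‖ ≤ M) : w ∈ fatouSet f := by
  refine mem_fatouSet_of_exists_subseq hV hw hiter 0 fun s _ => ?_
  obtain ⟨φ, hφ, h, hlim⟩ := exists_subseq_tendstoLocallyUniformlyOn_of_montel hV
    (fun k => hu (s k)) fun p hp => ⟨V, hV.mem_nhds hp, M, .of_forall fun k => hM (s k)⟩
  exact ⟨φ, hφ, _, tendstoLocallyUniformlyOn_comp_of_continuousAt hlim hV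
    (hlim.continuousOn (.of_forall fun k => (hu _).continuousOn)) (J := fun _ v => (v : Sphere))
    fun _ _ => OnePoint.continuous_coe.continuousAt.comp continuousAt_snd⟩

end NormalityCriteria

/-! ### Holomorphic self-maps -/

/-- `f` restricts to a holomorphic map `F` of the open set `X` into itself. Below, `X` is the plane
or a once punctured plane on which all iterates of `f` are finite. -/
structure IsHolomorphicSelfMap (f : ℂ → Sphere) (F : ℂ → ℂ) (X : Set ℂ) : Prop where
  isOpen : IsOpen X
  coe_eq : ∀ z ∈ X, f z = (F z : Sphere)
  mapsTo : MapsTo F X X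
  differentiableOn : DifferentiableOn ℂ F X

/-- Along the sequence `n`, the iterates of `F` eventually map a fixed neighbourhood of `p` into a
fixed compact subset of `X`; this is the local boundedness that makes them a normal family of maps
into `X`. -/
def CompactlyBoundedAt (F : ℂ → ℂ) (X : Set ℂ) (n : ℕ → ℕ) (p : ℂ) : Prop :=
  ∃ N ∈ 𝓝 p, ∃ A ⊆ X, IsCompact A ∧ ∀ᶠ k in atTop, MapsTo F^[n k] N A

namespace CompactlyBoundedAt

variable {F : ℂ → ℂ} {X : Set ℂ} {n : ℕ → ℕ} {p : ℂ}

theorem eventually_nhds (hb : CompactlyBoundedAt F X n p) :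
    ∀ᶠ x in 𝓝 p, CompactlyBoundedAt F X n x := by
  obtain ⟨N, hN, A, hAX, hA, hNA⟩ := hb
  filter_upwards [eventually_mem_nhds_iff.2 hN] with x hx
  exact ⟨N, hx, A, hAX, hA, hNA⟩

theorem exists_isCompact_eventually_mapsTo {K : Set ℂ} (hK : IsCompact K)
    (hb : ∀ x ∈ K, CompactlyBoundedAt F X n x) :
    ∃ A ⊆ X, IsCompact A ∧ ∀ᶠ k in atTop, MapsTo F^[n k] K A := by
  refine hK.induction_on
    (p := fun s => ∃ A ⊆ X, IsCompact A ∧ ∀ᶠ k in atTop, MapsTo F^[n k] s A) ?_ ?_ ?_ ?_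
  · exact ⟨∅, empty_subset X, isCompact_empty, .of_forall fun _ => mapsTo_empty _ _⟩
  · rintro s t hst ⟨A, hAX, hA, hsA⟩
    exact ⟨A, hAX, hA, hsA.mono fun k hk => hk.mono_left hst⟩
  · rintro s t ⟨A, hAX, hA, hsA⟩ ⟨B, hBX, hB, htB⟩
    refine ⟨A ∪ B, union_subset hAX hBX, hA.union hB, ?_⟩
    filter_upwards [hsA, htB] with k hs ht
    exact hs.union_union ht
  · intro x hx
    obtain ⟨N, hN, hNA⟩ := hb x hx
    exact ⟨N, mem_nhdsWithin_of_mem_nhds hN, hNA⟩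

theorem of_sphere {r : ℝ} (hr : 0 < r) (hF : Differentiable ℂ F)
    (hb : ∀ x ∈ sphere p r, CompactlyBoundedAt F univ n x) : CompactlyBoundedAt F univ n p := by
  obtain ⟨A, -, hA, hsA⟩ := exists_isCompact_eventually_mapsTo (isCompact_sphere p r) hb
  obtain ⟨M, hM⟩ := isBounded_iff_forall_norm_le.1 hA.isBounded
  refine ⟨closedBall p r, closedBall_mem_nhds p hr, closedBall 0 M, subset_univ _,
    isCompact_closedBall _ _, ?_⟩
  filter_upwards [hsA] with k hk x hx
  rw [← closure_ball p hr.ne'] at hx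
  refine mem_closedBall_zero_iff.2 (Complex.norm_le_of_forall_mem_frontier_norm_le
    (U := ball p r) isBounded_ball (hF.iterate _).diffContOnCl (fun z hz => hM _ (hk ?_)) hx)
  rwa [frontier_ball p hr.ne'] at hz

end CompactlyBoundedAt

theorem isPreconnected_of_subsingleton_compl {X : Set ℂ} (hX : Xᶜ.Subsingleton) :
    IsPreconnected X := by
  have hconn := hX.countable.isConnected_compl_of_one_lt_rank
    (E := ℂ) (by rw [Complex.rank_real_complex]; exact Cardinal.one_lt_two)
  rw [compl_compl] at hconn
  exact hconn.isPreconnected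

namespace IsHolomorphicSelfMap

variable {f : ℂ → Sphere} {F : ℂ → ℂ} {X : Set ℂ} {n : ℕ → ℕ} {w : ℂ}

theorem mapsTo_iterate (h : IsHolomorphicSelfMap f F X) (n : ℕ) : MapsTo F^[n] X X :=
  h.mapsTo.iterate n

theorem iter_eq (h : IsHolomorphicSelfMap f F X) (n : ℕ) {z : ℂ} (hz : z ∈ X) :
    iter f n z = (F^[n] z : Sphere) := by
  induction n with
  | zero => rfl
  | succ n ih =>
    rw [iter_succ, ih, sphereExt_coe, h.coe_eq _ (h.mapsTo_iterate n hz),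
      Function.iterate_succ_apply']

theorem differentiableOn_iterate (h : IsHolomorphicSelfMap f F X) (n : ℕ) :
    DifferentiableOn ℂ F^[n] X :=
  h.differentiableOn.iterate h.mapsTo n

theorem mem_fatouSet_of_mapsTo_compact (h : IsHolomorphicSelfMap f F X) {K : Set ℂ}
    (hK : IsCompact K) (hKX : K ⊆ X) (hw : K ∈ 𝓝 w) {n : ℕ} (hn : 0 < n)
    (hm : MapsTo F^[n] K K) : w ∈ fatouSet f := by
  have hcomp : IsCompact (⋃ i ∈ Finset.range n, F^[i] '' K) :=
    (Finset.range n).isCompact_biUnion fun i _ =>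
      hK.image_of_continuousOn ((h.differentiableOn_iterate i).continuousOn.mono hKX)
  obtain ⟨M, hM⟩ := isBounded_iff_forall_norm_le.1 hcomp.isBounded
  have hint : interior K ⊆ X := interior_subset.trans hKX
  refine mem_fatouSet_of_bounded isOpen_interior (mem_interior_iff_mem_nhds.2 hw)
    (fun m z hz => h.iter_eq m (hint hz)) (fun m => (h.differentiableOn_iterate m).mono hint)
    (M := M) fun m z hz => hM _ ?_
  refine mem_biUnion (Finset.mem_coe.2 (Finset.mem_range.2 (Nat.mod_lt m hn)))
    ⟨(F^[n])^[m / n] z, hm.iterate _ (interior_subset hz), ?_⟩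
  rw [← Function.iterate_mul, ← Function.iterate_add_apply, Nat.mod_add_div]

theorem exists_iterate_eq_or_eq (h : IsHolomorphicSelfMap f F X) (hw : w ∈ X)
    (hJ : w ∉ fatouSet f) {D : Set ℂ} (hD : D ∈ 𝓝 w) {a b : ℂ} (hab : a ≠ b) :
    ∃ m, ∃ x ∈ D ∩ X, F^[m] x = a ∨ F^[m] x = b := by
  by_contra! hcon
  exact hJ (mem_fatouSet_of_omits (inter_mem hD (h.isOpen.mem_nhds hw))
    (fun n z hz => h.iter_eq n hz.2)
    (fun n => (h.differentiableOn_iterate n).mono inter_subset_right) hab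
    (fun n z hz => (hcon n z hz).1) (fun n z hz => (hcon n z hz).2))

theorem exists_periodic_of_notMem (h : IsHolomorphicSelfMap f F X) {a : ℂ} (ha : a ∉ X)
    (hw : w ∈ X) (hJ : w ∉ fatouSet f) {D : Set ℂ} (hD : D ∈ 𝓝 w) :
    ∃ p ∈ D, ∃ m, 0 < m ∧ Function.IsPeriodicPt F m p := by
  by_contra! hcon
  obtain ⟨R, hR, hball⟩ := Metric.mem_nhds_iff.1 (inter_mem hD (h.isOpen.mem_nhds hw))
  have hBX : ball w R ⊆ X := fun x hx => (hball hx).2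
  have hne : ∀ z ∈ X, z ≠ a := fun z hz hza => ha (hza ▸ hz)
  have hsub : ball w (R / 2) ⊆ ball w R := ball_subset_ball (half_le_self hR.le)
  exact hJ (mem_fatouSet_of_exists_subseq isOpen_ball (mem_ball_self (half_pos hR))
    (fun n z hz => h.iter_eq n (hBX (hsub hz))) 1 fun s hs =>
      exists_subseq_tendstoLocallyUniformlyOn_of_omits
        (fun k => (h.differentiableOn_iterate (s k)).mono hBX) differentiableOn_id
        (fun z hz => hne z (hBX hz)) (fun k z hz => hne _ (h.mapsTo_iterate _ (hBX hz)))
        (fun k z hz => hcon z (hball hz).1 (s k) (hs k)))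

theorem mem_fatouSet_of_iterate_mem (h : IsHolomorphicSelfMap f F X) (hw : w ∈ X) {m : ℕ}
    (hm : F^[m] w ∈ fatouSet f) : w ∈ fatouSet f := by
  obtain ⟨V, hV, hwV, -, hnorm⟩ := hm
  have hcont : ContinuousOn F^[m] X := (h.differentiableOn_iterate m).continuousOn
  refine mem_fatouSet_of_exists_subseq (hcont.isOpen_inter_preimage h.isOpen hV) ⟨hw, hwV⟩
    (fun n z hz => h.iter_eq n hz.1) m fun s hs => ?_
  obtain ⟨φ, hφ, H, hlim⟩ := hnorm fun k => s k - m
  refine ⟨φ, hφ, H ∘ F^[m], (hlim.comp F^[m] (t := X ∩ F^[m] ⁻¹' V) (fun z hz => hz.2)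
    (hcont.mono inter_subset_left)).congr fun k z hz => ?_⟩
  simp only [Function.comp_apply]
  rw [h.iter_eq _ (h.mapsTo_iterate m hz.1), ← Function.iterate_add_apply,
    Nat.sub_add_cancel (hs _)]

theorem not_const_of_notMem (h : IsHolomorphicSelfMap f F X) (hw : w ∈ X)
    (hJ : w ∉ fatouSet f) : ¬ ∃ c, ∀ z ∈ X, F z = c := by
  rintro ⟨c, hc⟩
  obtain ⟨K, hKw, hKX, hK⟩ := local_compact_nhds (h.isOpen.mem_nhds hw)
  have hcX : insert c K ⊆ X := insert_subset (hc w hw ▸ h.mapsTo hw) hKX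
  exact hJ (h.mem_fatouSet_of_mapsTo_compact (hK.insert c) hcX
    (mem_of_superset hKw (subset_insert c K)) one_pos fun z hz => Or.inl (hc z (hcX hz)))

theorem nhds_le_map_iterate (h : IsHolomorphicSelfMap f F X) (hXc : IsPreconnected X)
    (hne : ¬ ∃ c, ∀ z ∈ X, F z = c) (m : ℕ) {x : ℂ} (hx : x ∈ X) :
    𝓝 (F^[m] x) ≤ map F^[m] (𝓝 x) := by
  have hopen : ∀ y ∈ X, 𝓝 (F y) ≤ map F (𝓝 y) := by
    intro y hy
    have han := h.differentiableOn.analyticOnNhd h.isOpen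
    refine (han y hy).eventually_constant_or_nhds_le_map_nhds.resolve_left fun hc => hne ⟨F y, ?_⟩
    exact han.eqOn_of_preconnected_of_eventuallyEq analyticOnNhd_const hXc hy hc
  induction m with
  | zero => exact le_rfl
  | succ m ih =>
    rw [Function.iterate_succ', ← map_map]
    exact (hopen _ (h.mapsTo_iterate m hx)).trans (map_mono ih)

theorem compactlyBoundedAt_iterate (h : IsHolomorphicSelfMap f F X) (hXc : IsPreconnected X)
    (hne : ¬ ∃ c, ∀ z ∈ X, F z = c) {x : ℂ} (hx : x ∈ X) (hb : CompactlyBoundedAt F X n x)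
    (m : ℕ) : CompactlyBoundedAt F X n (F^[m] x) := by
  obtain ⟨N, hN, A, hAX, hA, hNA⟩ := hb
  refine ⟨F^[m] '' N, h.nhds_le_map_iterate hXc hne m hx (image_mem_map hN), F^[m] '' A,
    ((h.mapsTo_iterate m).mono_left hAX).image_subset,
    hA.image_of_continuousOn ((h.differentiableOn_iterate m).continuousOn.mono hAX), ?_⟩
  filter_upwards [hNA] with k hk
  rintro _ ⟨y, hy, rfl⟩
  exact ⟨_, hk hy, (Function.Commute.iterate_iterate_self F m (n k)) y⟩

theorem compactlyBoundedAt_or_of_ne (h : IsHolomorphicSelfMap f F X) (hXc : IsPreconnected X)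
    (hw : w ∈ X) (hJ : w ∉ fatouSet f) (hb : CompactlyBoundedAt F X n w) {a b : ℂ} (hab : a ≠ b) :
    (a ∈ X ∧ CompactlyBoundedAt F X n a) ∨ (b ∈ X ∧ CompactlyBoundedAt F X n b) := by
  obtain ⟨m, x, ⟨hxb, hxX⟩, hxm⟩ := h.exists_iterate_eq_or_eq hw hJ hb.eventually_nhds hab
  have hstep : F^[m] x ∈ X ∧ CompactlyBoundedAt F X n (F^[m] x) :=
    ⟨h.mapsTo_iterate m hxX,
      h.compactlyBoundedAt_iterate hXc (h.not_const_of_notMem hw hJ) hxX hxb m⟩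
  rcases hxm with rfl | rfl
  · exact Or.inl hstep
  · exact Or.inr hstep

theorem compactlyBoundedAt_of_notMem (h : IsHolomorphicSelfMap f F X) (hX : Xᶜ.Subsingleton)
    (hw : w ∈ X) (hJ : w ∉ fatouSet f) (hb : CompactlyBoundedAt F X n w) :
    ∀ p ∈ X, CompactlyBoundedAt F X n p := by
  intro p hp
  have hor := fun a b (hab : a ≠ b) => h.compactlyBoundedAt_or_of_ne
    (isPreconnected_of_subsingleton_compl hX) hw hJ hb hab
  rcases hX.eq_empty_or_singleton with hXe | ⟨a, hXa⟩
  · obtain rfl : X = univ := compl_empty_iff.1 hXe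
    by_contra hcon
    refine hcon (CompactlyBoundedAt.of_sphere one_pos (differentiableOn_univ.1 h.differentiableOn)
      fun x hx => ?_)
    exact ((hor p x (ne_of_mem_sphere hx one_ne_zero).symm).resolve_left fun hpb =>
      hcon hpb.2).2
  · have ha : a ∉ X := notMem_of_mem_compl (hXa ▸ mem_singleton a)
    exact ((hor a p fun hap => ha (hap ▸ hp)).resolve_left fun hab => ha hab.1).2

theorem exists_subseq_of_compactlyBoundedAt (h : IsHolomorphicSelfMap f F X)
    (hb : ∀ p ∈ X, CompactlyBoundedAt F X n p) :
    ∃ φ : ℕ → ℕ, StrictMono φ ∧ ∃ H : ℂ → ℂ, MapsTo H X X ∧ DifferentiableOn ℂ H X ∧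
      TendstoLocallyUniformlyOn (fun k => F^[n (φ k)]) H atTop X := by
  obtain ⟨φ, hφ, H, hlim⟩ := exists_subseq_tendstoLocallyUniformlyOn_of_montel h.isOpen
    (u := fun k => F^[n k]) (fun k => h.differentiableOn_iterate _) fun p hp => by
      obtain ⟨N, hN, A, -, hA, hNA⟩ := hb p hp
      obtain ⟨M, hM⟩ := isBounded_iff_forall_norm_le.1 hA.isBounded
      exact ⟨N, hN, M, hNA.mono fun k hk x hx => hM _ (hk hx)⟩
  refine ⟨φ, hφ, H, fun p hp => ?_, hlim.differentiableOn
    (.of_forall fun k => h.differentiableOn_iterate _) h.isOpen, hlim⟩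
  obtain ⟨N, hN, A, hAX, hA, hNA⟩ := hb p hp
  refine hAX (hA.isClosed.mem_of_tendsto (hlim.tendsto_at hp) ?_)
  filter_upwards [hφ.tendsto_atTop.eventually hNA] with k hk
  exact hk (mem_of_mem_nhds hN)

end IsHolomorphicSelfMap

/-! ### Self-maps with iterates tending to the identity -/

theorem injOn_of_tendsto_iterate_id {α : Type*} [TopologicalSpace α] [T2Space α] {F : α → α}
    {X : Set α} {m : ℕ → ℕ} (hm : ∀ k, 0 < m k)
    (hlim : ∀ z ∈ X, Tendsto (fun k => F^[m k] z) atTop (𝓝 z)) : InjOn F X := by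
  intro x hx y hy hxy
  refine tendsto_nhds_unique (hlim x hx) ((hlim y hy).congr fun k => ?_)
  obtain ⟨j, hj⟩ := Nat.exists_eq_succ_of_ne_zero (hm k).ne'
  rw [hj, Function.iterate_succ_apply, Function.iterate_succ_apply, hxy]

section AffineMaps

variable {F : ℂ → ℂ} {α β p : ℂ} {m : ℕ → ℕ}

theorem iterate_sub_eq_pow_mul (hF : ∀ z, F z - p = α * (z - p)) (n : ℕ) (z : ℂ) :
    F^[n] z - p = α ^ n * (z - p) := by
  induction n with
  | zero => simp
  | succ n ih => rw [Function.iterate_succ_apply', hF, ih, pow_succ']; ring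

theorem exists_fixedPt_of_tendsto_id (hF : ∀ z, F z = α * z + β) (hm : ∀ k, 0 < m k)
    (hlim : Tendsto (fun k => F^[m k] 0) atTop (𝓝 0)) : ∃ p, F p = p := by
  rcases eq_or_ne α 1 with rfl | hα
  · have htrans : ∀ n : ℕ, F^[n] 0 = n * β := by
      intro n
      induction n with
      | zero => simp
      | succ n ih => rw [Function.iterate_succ_apply', ih, hF]; push_cast; ring
    have hβ : ‖β‖ ≤ ‖(0 : ℂ)‖ := ge_of_tendsto' hlim.norm fun k => by
      rw [htrans, norm_mul, Complex.norm_natCast]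
      exact le_mul_of_one_le_left (norm_nonneg β) (Nat.one_le_cast.2 (hm k))
    rw [norm_zero, norm_le_zero_iff] at hβ
    exact ⟨0, by rw [hF, hβ, mul_zero, add_zero]⟩
  · have hα' : 1 - α ≠ 0 := sub_ne_zero.2 hα.symm
    exact ⟨β / (1 - α), by rw [hF]; field_simp; ring⟩

theorem norm_multiplier_le_one_of_tendsto_id (hF : ∀ z, F z - p = α * (z - p))
    (hm : ∀ k, 0 < m k) (hlim : Tendsto (fun k => F^[m k] (p + 1)) atTop (𝓝 (p + 1))) :
    ‖α‖ ≤ 1 := by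
  by_contra! hα
  have hle : ‖α‖ ≤ ‖p + 1 - p‖ := ge_of_tendsto' (hlim.sub_const p).norm fun k => by
    rw [iterate_sub_eq_pow_mul hF, add_sub_cancel_left, mul_one, norm_pow]
    exact le_self_pow₀ hα.le (hm k).ne'
  rw [add_sub_cancel_left, norm_one] at hle
  exact hle.not_gt hα

end AffineMaps

theorem exists_sub_eq_inv_mul_of_injOn_compl_singleton {F : ℂ → ℂ} {a : ℂ}
    (hd : DifferentiableOn ℂ F {a}ᶜ) (hFa : ∀ z ≠ a, F z ≠ a)
    (hpole : Tendsto F (𝓝[≠] a) (Bornology.cobounded ℂ)) (hinj : InjOn F {a}ᶜ) :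
    ∃ α : ℂ, ∀ z ≠ a, F z - a = (α * (z - a))⁻¹ := by
  classical
  let G : ℂ → ℂ := Function.update (fun z => (F z - a)⁻¹) a 0
  have hGne : ∀ z ≠ a, G z = (F z - a)⁻¹ := fun z hz => Function.update_of_ne hz _ _
  have hGa : G a = 0 := Function.update_self _ _ _
  have hG0 : ∀ z ≠ a, G z ≠ 0 := fun z hz => by
    rw [hGne z hz]
    exact inv_ne_zero (sub_ne_zero.2 (hFa z hz))
  have hGcont : ContinuousAt G a := by
    rw [continuousAt_update_same]
    simpa only [sub_eq_add_neg, Function.comp_def] using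
      tendsto_inv₀_cobounded.comp ((tendsto_add_const_cobounded (-a)).comp hpole)
  have hGd : Differentiable ℂ G := by
    rw [← differentiableOn_univ,
      ← Complex.differentiableOn_compl_singleton_and_continuousAt_iff (univ_mem : univ ∈ 𝓝 a)]
    refine ⟨DifferentiableOn.congr (f := fun z => (F z - a)⁻¹) ?_ fun z hz => hGne z hz.2, hGcont⟩
    exact ((hd.sub_const a).inv fun z hz => sub_ne_zero.2 (hFa z hz)).mono fun z hz => hz.2
  have hGinj : Function.Injective G := by
    intro x y hxy
    rcases eq_or_ne x a with rfl | hx <;> rcases eq_or_ne y x with rfl | hyx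
    · rfl
    · exact absurd (hxy.symm.trans hGa) (hG0 y hyx)
    · rfl
    · rcases eq_or_ne y a with rfl | hy
      · exact absurd (hxy.trans hGa) (hG0 x hx)
      · rw [hGne x hx, hGne y hy, inv_inj] at hxy
        exact hinj hx hy (sub_left_injective hxy)
  obtain ⟨α, β, hαβ⟩ := exists_eq_mul_add_of_injective hGd hGinj
  refine ⟨α, fun z hz => ?_⟩
  rw [← inv_inv (F z - a), ← hGne z hz, hαβ]
  congr 1
  linear_combination (hαβ a).symm.trans hGa

namespace IsHolomorphicSelfMap

variable {f : ℂ → Sphere} {F : ℂ → ℂ} {X : Set ℂ} {w : ℂ}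

theorem mem_fatouSet_of_tendsto_id_univ (h : IsHolomorphicSelfMap f F univ) {m : ℕ → ℕ}
    (hm : ∀ k, 0 < m k) (hinj : Function.Injective F)
    (hlim : ∀ z, Tendsto (fun k => F^[m k] z) atTop (𝓝 z)) (w : ℂ) : w ∈ fatouSet f := by
  obtain ⟨α, β, hF⟩ := exists_eq_mul_add_of_injective (differentiableOn_univ.1 h.differentiableOn)
    hinj
  obtain ⟨p, hp⟩ := exists_fixedPt_of_tendsto_id hF hm (hlim 0)
  have hFp : ∀ z, F z - p = α * (z - p) := fun z => by
    linear_combination hF z + hp - hF p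
  have hα : ‖α‖ ≤ 1 := norm_multiplier_le_one_of_tendsto_id hFp hm (hlim (p + 1))
  refine h.mem_fatouSet_of_mapsTo_compact (isCompact_closedBall p (dist w p + 1)) (subset_univ _)
    (closedBall_mem_nhds_of_mem (mem_ball.2 (lt_add_one _))) one_pos fun z hz => ?_
  rw [mem_closedBall_iff_norm] at hz ⊢
  rw [Function.iterate_one, hFp, norm_mul]
  exact (mul_le_of_le_one_left (norm_nonneg _) hα).trans hz

theorem mem_fatouSet_of_injOn_compl_singleton {a : ℂ} (h : IsHolomorphicSelfMap f F {a}ᶜ)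
    (hpole : Tendsto F (𝓝[≠] a) (Bornology.cobounded ℂ)) (hinj : InjOn F {a}ᶜ)
    (hw : w ≠ a) : w ∈ fatouSet f := by
  obtain ⟨α, hα⟩ := exists_sub_eq_inv_mul_of_injOn_compl_singleton h.differentiableOn
    (fun z hz => h.mapsTo hz) hpole hinj
  have hinvol : ∀ z ≠ a, F (F z) = z := by
    intro z hz
    have hα0 : α ≠ 0 := by
      rintro rfl
      exact h.mapsTo hz (sub_eq_zero.1 (by rw [hα z hz, zero_mul, inv_zero]))
    refine sub_left_injective (b := a) ?_
    change F (F z) - a = z - a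
    rw [hα _ (h.mapsTo hz), hα z hz, mul_inv, inv_inv, inv_mul_cancel_left₀ hα0]
  obtain ⟨K, hKw, hKX, hK⟩ := local_compact_nhds (h.isOpen.mem_nhds hw)
  refine h.mem_fatouSet_of_mapsTo_compact hK hKX hKw two_pos fun z hz => ?_
  change F (F z) ∈ K
  rwa [hinvol z (hKX hz)]

theorem mem_fatouSet_of_tendsto_id (h : IsHolomorphicSelfMap f F X) (hX : Xᶜ.Subsingleton)
    (hpole : ∀ a ∉ X, Tendsto F (𝓝[≠] a) (Bornology.cobounded ℂ)) {m : ℕ → ℕ}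
    (hm : ∀ k, 0 < m k) (hlim : ∀ z ∈ X, Tendsto (fun k => F^[m k] z) atTop (𝓝 z))
    (hw : w ∈ X) : w ∈ fatouSet f := by
  have hinj : InjOn F X := injOn_of_tendsto_iterate_id hm hlim
  rcases hX.eq_empty_or_singleton with hXe | ⟨a, hXa⟩
  · obtain rfl : X = univ := compl_empty_iff.1 hXe
    exact h.mem_fatouSet_of_tendsto_id_univ hm (injOn_univ.1 hinj)
      (fun z => hlim z (mem_univ z)) w
  · obtain rfl : X = {a}ᶜ := by rw [← hXa, compl_compl]
    exact h.mem_fatouSet_of_injOn_compl_singleton (hpole a fun ha => ha rfl) hinj hw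

end IsHolomorphicSelfMap

/-! ### Bounded subsequences of iterates -/

theorem iterate_sub_apply_iterate {α : Type*} (F : α → α) {i j : ℕ} (hij : i ≤ j) (x : α) :
    F^[j - i] (F^[i] x) = F^[j] x := by
  rw [← Function.iterate_add_apply, Nat.sub_add_cancel hij]

theorem CompactlyBoundedAt.comp_tendsto {F : ℂ → ℂ} {X : Set ℂ} {n : ℕ → ℕ} {p : ℂ}
    (hb : CompactlyBoundedAt F X n p) {φ : ℕ → ℕ} (hφ : Tendsto φ atTop atTop) :
    CompactlyBoundedAt F X (n ∘ φ) p := by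
  obtain ⟨N, hN, A, hAX, hA, hNA⟩ := hb
  exact ⟨N, hN, A, hAX, hA, hφ.eventually hNA⟩

namespace IsHolomorphicSelfMap

variable {f : ℂ → Sphere} {F : ℂ → ℂ} {X : Set ℂ} {n : ℕ → ℕ} {H : ℂ → ℂ} {w : ℂ}

theorem mem_fatouSet_of_tendsto_const (h : IsHolomorphicSelfMap f F X) (hn : StrictMono n)
    {c : ℂ} (hc : c ∈ X) (hlim : TendstoLocallyUniformlyOn (fun k => F^[n k]) (fun _ => c) atTop X)
    (hw : w ∈ X) : w ∈ fatouSet f := by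
  obtain ⟨K₁, hK₁w, hK₁X, hK₁⟩ := local_compact_nhds (h.isOpen.mem_nhds hw)
  obtain ⟨K₂, hK₂c, hK₂X, hK₂⟩ := local_compact_nhds (h.isOpen.mem_nhds hc)
  obtain ⟨ε, hε, hball⟩ := Metric.mem_nhds_iff.1 hK₂c
  have hunif := (tendstoLocallyUniformlyOn_iff_forall_isCompact h.isOpen).1 hlim _
    (union_subset hK₁X hK₂X) (hK₁.union hK₂)
  obtain ⟨k, hk, hk0⟩ := ((Metric.tendstoUniformlyOn_iff.1 hunif ε hε).and
    (hn.tendsto_atTop.eventually_gt_atTop 0)).exists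
  exact h.mem_fatouSet_of_mapsTo_compact (hK₁.union hK₂) (union_subset hK₁X hK₂X)
    (mem_of_superset hK₁w subset_union_left) hk0 fun z hz =>
      Or.inr (hball (mem_ball'.2 (hk z hz)))

theorem limit_notMem_fatouSet (h : IsHolomorphicSelfMap f F X) (hw : w ∈ X)
    (hJ : w ∉ fatouSet f) (hlim : Tendsto (fun k => F^[n k] w) atTop (𝓝 (H w))) :
    H w ∉ fatouSet f := fun hH =>
  (hlim.eventually ((isOpen_fatouSet f).mem_nhds hH)).exists.elim fun _ hk =>
    hJ (h.mem_fatouSet_of_iterate_mem hw hk)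

theorem compactlyBoundedAt_sub (h : IsHolomorphicSelfMap f F X) (hn : Monotone n)
    (hlim : TendstoLocallyUniformlyOn (fun k => F^[n k]) H atTop X) (hw : w ∈ X)
    (hne : ¬ ∀ᶠ z in 𝓝 w, H z = H w) (hb : CompactlyBoundedAt F X n w) :
    CompactlyBoundedAt F X (fun k => n (k + 1) - n k) (H w) := by
  obtain ⟨N, hN, A, hAX, hA, hNA⟩ := hb.comp_tendsto (tendsto_add_atTop_nat 1)
  obtain ⟨ε, hε, himg⟩ := exists_ball_subset_image_of_hurwitz h.isOpen
    (fun k => h.differentiableOn_iterate _) hlim hw hne hN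
  refine ⟨ball (H w) ε, ball_mem_nhds _ hε, A, hAX, hA, ?_⟩
  filter_upwards [himg, hNA] with k himg hNA y hy
  obtain ⟨x, hx, rfl⟩ := himg hy
  rw [iterate_sub_apply_iterate F (hn k.le_succ)]
  exact hNA hx

theorem eqOn_id_of_tendstoLocallyUniformlyOn_sub (h : IsHolomorphicSelfMap f F X)
    (hXc : IsPreconnected X) (hn : Monotone n)
    (hlim : TendstoLocallyUniformlyOn (fun k => F^[n k]) H atTop X) (hHX : MapsTo H X X)
    (hw : w ∈ X) (hne : ¬ ∀ᶠ z in 𝓝 w, H z = H w) {ψ : ℕ → ℕ} (hψ : Tendsto ψ atTop atTop)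
    {G : ℂ → ℂ}
    (hlimG : TendstoLocallyUniformlyOn (fun k => F^[n (ψ k + 1) - n (ψ k)]) G atTop X) :
    EqOn G id X := by
  have hd : ∀ {v : ℕ → ℕ} {L : ℂ → ℂ}, TendstoLocallyUniformlyOn (fun k => F^[v k]) L atTop X →
      DifferentiableOn ℂ L X := fun hL =>
    hL.differentiableOn (.of_forall fun k => h.differentiableOn_iterate _) h.isOpen
  have hfix : ∀ x ∈ X, G (H x) = H x := by
    intro x hx
    have hH : Tendsto (fun k => F^[n (ψ k)] x) atTop (𝓝 (H x)) := (hlim.tendsto_at hx).comp hψ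
    have hsucc : Tendsto (fun k => F^[n (ψ k + 1)] x) atTop (𝓝 (H x)) :=
      (hlim.tendsto_at hx).comp ((tendsto_add_atTop_nat 1).comp hψ)
    have hG := (tendsto_prod_nhds_of_tendstoLocallyUniformlyOn hlimG h.isOpen
      (hd hlimG).continuousOn (hHX hx)).comp (tendsto_id.prodMk hH)
    exact tendsto_nhds_unique hG
      (hsucc.congr fun k => (iterate_sub_apply_iterate F (hn (ψ k).le_succ) x).symm)
  refine ((hd hlimG).analyticOnNhd h.isOpen).eqOn_of_preconnected_of_eventuallyEq
    analyticOnNhd_id hXc (hHX hw) ?_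
  have hopen : 𝓝 (H w) ≤ map H (𝓝 w) :=
    (((hd hlim).analyticOnNhd h.isOpen) w hw).eventually_constant_or_nhds_le_map_nhds.resolve_left
      hne
  exact hopen (mem_map.2 (mem_of_superset (h.isOpen.mem_nhds hw) hfix))

theorem exists_tendsto_id_of_compactlyBoundedAt (h : IsHolomorphicSelfMap f F X)
    (hX : Xᶜ.Subsingleton) (hn : StrictMono n) (hw : w ∈ X) (hJ : w ∉ fatouSet f)
    (hb : CompactlyBoundedAt F X n w) :
    ∃ m : ℕ → ℕ, (∀ k, 0 < m k) ∧ ∀ z ∈ X, Tendsto (fun k => F^[m k] z) atTop (𝓝 z) := by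
  have hXc := isPreconnected_of_subsingleton_compl hX
  obtain ⟨φ, hφ, H, hHX, hHd, hlim⟩ := h.exists_subseq_of_compactlyBoundedAt
    (h.compactlyBoundedAt_of_notMem hX hw hJ hb)
  have hnφ : StrictMono (n ∘ φ) := hn.comp hφ
  have hne : ¬ ∀ᶠ z in 𝓝 w, H z = H w := fun hconst => by
    have hHw : EqOn H (fun _ => H w) X :=
      (hHd.analyticOnNhd h.isOpen).eqOn_of_preconnected_of_eventuallyEq analyticOnNhd_const hXc hw
        hconst
    exact hJ (h.mem_fatouSet_of_tendsto_const hnφ (hHX hw) (hlim.congr_right hHw) hw)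
  have hHJ : H w ∉ fatouSet f := h.limit_notMem_fatouSet hw hJ (hlim.tendsto_at hw)
  have hbH := h.compactlyBoundedAt_sub hnφ.monotone hlim hw hne (hb.comp_tendsto hφ.tendsto_atTop)
  obtain ⟨ψ, hψ, G, -, -, hlimG⟩ := h.exists_subseq_of_compactlyBoundedAt
    (h.compactlyBoundedAt_of_notMem hX (hHX hw) hHJ hbH)
  have hid : EqOn G id X := h.eqOn_id_of_tendstoLocallyUniformlyOn_sub hXc hnφ.monotone hlim hHX hw
    hne hψ.tendsto_atTop hlimG
  exact ⟨_, fun k => Nat.sub_pos_of_lt (hnφ (ψ k).lt_succ_self), fun z hz =>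
    (hlimG.congr_right hid).tendsto_at hz⟩

theorem not_compactlyBoundedAt_of_notMem (h : IsHolomorphicSelfMap f F X) (hX : Xᶜ.Subsingleton)
    (hpole : ∀ a ∉ X, Tendsto F (𝓝[≠] a) (Bornology.cobounded ℂ)) (hn : StrictMono n)
    (hw : w ∈ X) (hJ : w ∉ fatouSet f) : ¬ CompactlyBoundedAt F X n w := by
  intro hb
  obtain ⟨m, hm, hlim⟩ := h.exists_tendsto_id_of_compactlyBoundedAt hX hn hw hJ hb
  exact hJ (h.mem_fatouSet_of_tendsto_id hX hpole hm hlim hw)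

end IsHolomorphicSelfMap

/-! ### Iterated preimages of infinity -/

/-- The points at which some iterate of `f` takes the value `∞`. Off this set, `iter f n` is the
true `n`-th iterate for every `n`. -/
def prepoleSet (f : ℂ → Sphere) : Set ℂ := {z | ∃ n, iter f n z = OnePoint.infty}

section Prepole

variable {f : ℂ → Sphere} {m n : ℕ} {y z : ℂ}

theorem iter_add_of_iter_eq (h : iter f m z = (y : Sphere)) (n : ℕ) :
    iter f (n + m) z = iter f n y := by
  rw [iter, Function.iterate_add_apply]
  exact congrArg _ h

theorem iter_eq_infty_of_le (hmn : m ≤ n) (h : iter f m z = OnePoint.infty) :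
    iter f n z = OnePoint.infty := by
  induction n, hmn using Nat.le_induction with
  | base => exact h
  | succ n _ ih => rw [iter_succ, ih]; rfl

theorem notMem_prepoleSet_of_iter_eq (hz : z ∉ prepoleSet f) (h : iter f m z = (y : Sphere)) :
    y ∉ prepoleSet f :=
  fun ⟨n, hn⟩ => hz ⟨n + m, (iter_add_of_iter_eq h n).trans hn⟩

theorem coe_finitePart_iter (hz : z ∉ prepoleSet f) (n : ℕ) :
    (finitePart (iter f n z) : Sphere) = iter f n z :=
  coe_finitePart fun h => hz ⟨n, h⟩

theorem finitePart_iter_notMem_prepoleSet (hz : z ∉ prepoleSet f) (n : ℕ) :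
    finitePart (iter f n z) ∉ prepoleSet f :=
  notMem_prepoleSet_of_iter_eq hz (coe_finitePart_iter hz n).symm

theorem apply_ne_infty_of_notMem_prepoleSet (hz : z ∉ prepoleSet f) : f z ≠ OnePoint.infty :=
  fun h => hz ⟨1, h⟩

theorem iter_succ_of_notMem_prepoleSet (hz : z ∉ prepoleSet f) (n : ℕ) :
    iter f (n + 1) z = f (finitePart (iter f n z)) := by
  rw [iter_succ, ← coe_finitePart_iter hz n, sphereExt_coe, finitePart_coe]

theorem notMem_prepoleSet_of_tendsto_iter {s : ℕ → ℕ} (hs : StrictMono s)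
    (h : Tendsto (fun k => iter f (s k) z) atTop (𝓝 (y : Sphere))) : z ∉ prepoleSet f := by
  rintro ⟨m, hm⟩
  obtain ⟨k, hk, hmk⟩ := ((h.eventually_ne (OnePoint.coe_ne_infty y)).and
    (hs.tendsto_atTop.eventually_ge_atTop m)).exists
  exact hk (iter_eq_infty_of_le hmk hm)

theorem exists_apply_eq_infty (h : iter f n z = OnePoint.infty) :
    ∃ y, f y = OnePoint.infty := by
  induction n with
  | zero => exact absurd h (OnePoint.coe_ne_infty z)
  | succ n ih =>
    by_cases hn : iter f n z = OnePoint.infty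
    · exact ih hn
    · refine ⟨finitePart (iter f n z), ?_⟩
      rwa [iter_succ, ← coe_finitePart hn, sphereExt_coe] at h

theorem apply_eq_infty_of_mem_prepoleSet (hE : (prepoleSet f).Subsingleton)
    (hz : z ∈ prepoleSet f) : f z = OnePoint.infty := by
  obtain ⟨n, hn⟩ := hz
  obtain ⟨y, hy⟩ := exists_apply_eq_infty hn
  rwa [← hE ⟨1, hy⟩ ⟨n, hn⟩]

end Prepole

namespace CommutingFun

variable {f g : ℂ → Sphere} {z : ℂ}

theorem apply_eq_infty_iff (hfg : CommutingFun f g) (z : ℂ) :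
    f z = OnePoint.infty ↔ g z = OnePoint.infty := by
  rcases hfg z with ⟨hg, hf, -⟩ | ⟨hg, hf⟩
  · exact iff_of_false hf hg
  · exact iff_of_true hf hg

theorem apply_ne_infty (hfg : CommutingFun f g) (hz : z ∉ prepoleSet f) : g z ≠ OnePoint.infty :=
  (hfg.apply_eq_infty_iff z).not.1 (apply_ne_infty_of_notMem_prepoleSet hz)

theorem apply_finitePart (hfg : CommutingFun f g) (hz : z ∉ prepoleSet f) :
    f (finitePart (g z)) = g (finitePart (f z)) := by
  rcases hfg z with ⟨hg, hf, h⟩ | ⟨hg, -⟩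
  · rwa [← coe_finitePart hg, ← coe_finitePart hf, sphereExt_coe, sphereExt_coe] at h
  · exact absurd hg (hfg.apply_ne_infty hz)

theorem iter_finitePart (hfg : CommutingFun f g) (hz : z ∉ prepoleSet f) (n : ℕ) :
    iter f n (finitePart (g z)) = g (finitePart (iter f n z)) := by
  induction n with
  | zero => exact coe_finitePart (hfg.apply_ne_infty hz)
  | succ n ih =>
    have hzn := finitePart_iter_notMem_prepoleSet hz n
    rw [iter_succ, ih, ← coe_finitePart (hfg.apply_ne_infty hzn), sphereExt_coe,
      hfg.apply_finitePart hzn, iter_succ_of_notMem_prepoleSet hz]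

theorem finitePart_notMem_prepoleSet (hfg : CommutingFun f g) (hz : z ∉ prepoleSet f) :
    finitePart (g z) ∉ prepoleSet f := by
  rintro ⟨n, hn⟩
  rw [hfg.iter_finitePart hz] at hn
  exact hfg.apply_ne_infty (finitePart_iter_notMem_prepoleSet hz n) hn

end CommutingFun

namespace IsMeromorphicFun

variable {f : ℂ → Sphere} {U : Set ℂ} {w : ℂ}

theorem differentiableOn_finitePart_iter (hf : IsMeromorphicFun f) (n : ℕ) :
    DifferentiableOn ℂ (fun z => finitePart (iter f n z)) (prepoleSet f)ᶜ := by
  induction n with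
  | zero => exact differentiableOn_id
  | succ n ih =>
    intro z hz
    have hfn : DifferentiableAt ℂ (fun x => finitePart (f x)) (finitePart (iter f n z)) :=
      (hf.analyticAt_finitePart (apply_ne_infty_of_notMem_prepoleSet
        (finitePart_iter_notMem_prepoleSet hz n))).differentiableAt
    refine (hfn.comp_differentiableWithinAt z (ih z hz)).congr (fun x hx => ?_) ?_
    · exact congrArg finitePart (iter_succ_of_notMem_prepoleSet hx n)
    · exact congrArg finitePart (iter_succ_of_notMem_prepoleSet hz n)

theorem tendstoLocallyUniformlyOn_finitePart_iter (hf : IsMeromorphicFun f) (hU : IsOpen U)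
    (hUE : U ⊆ (prepoleSet f)ᶜ) {n : ℕ → ℕ} {φ : ℂ → ℂ}
    (hlim : TendstoLocallyUniformlyOn (fun k => iter f (n k)) (fun z => (φ z : Sphere)) atTop U) :
    TendstoLocallyUniformlyOn (fun k z => finitePart (iter f (n k) z)) φ atTop U := by
  have hiter : ∀ k, ContinuousOn (iter f (n k)) U := fun k =>
    (OnePoint.continuous_coe.comp_continuousOn
      ((hf.differentiableOn_finitePart_iter (n k)).continuousOn.mono hUE)).congr
      fun z hz => (coe_finitePart_iter (hUE hz) (n k)).symm
  exact tendstoLocallyUniformlyOn_comp_of_continuousAt hlim hU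
    (hlim.continuousOn (.of_forall hiter)) (J := fun _ v => finitePart v) fun z _ =>
      ContinuousAt.comp (f := Prod.snd) (continuousAt_finitePart (OnePoint.coe_ne_infty (φ z)))
        continuousAt_snd

theorem mem_fatouSet_of_not_subsingleton (hf : IsMeromorphicFun f)
    (hE : ¬ (prepoleSet f).Subsingleton) (hw : (prepoleSet f)ᶜ ∈ 𝓝 w) : w ∈ fatouSet f := by
  obtain ⟨a, ha, b, hb, hab⟩ := not_subsingleton_iff.1 hE
  refine mem_fatouSet_of_omits hw (fun n z hz => (coe_finitePart_iter hz n).symm)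
    hf.differentiableOn_finitePart_iter hab ?_ ?_
  · rintro n z hz rfl
    exact finitePart_iter_notMem_prepoleSet hz n ha
  · rintro n z hz rfl
    exact finitePart_iter_notMem_prepoleSet hz n hb

theorem isHolomorphicSelfMap (hf : IsMeromorphicFun f) (hE : IsClosed (prepoleSet f)) :
    IsHolomorphicSelfMap f (fun z => finitePart (f z)) (prepoleSet f)ᶜ where
  isOpen := hE.isOpen_compl
  coe_eq _ hz := (coe_finitePart (apply_ne_infty_of_notMem_prepoleSet hz)).symm
  mapsTo _ hz := finitePart_iter_notMem_prepoleSet hz 1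
  differentiableOn := hf.differentiableOn_finitePart_iter 1

theorem tendsto_cobounded (hf : IsMeromorphicFun f) (hE : (prepoleSet f).Subsingleton) {a : ℂ}
    (ha : a ∈ prepoleSet f) :
    Tendsto (fun z => finitePart (f z)) (𝓝[≠] a) (Bornology.cobounded ℂ) := by
  rw [cobounded_eq_cocompact, ← coclosedCompact_eq_cocompact, ← OnePoint.comap_coe_nhds_infty,
    tendsto_comap_iff, ← apply_eq_infty_of_mem_prepoleSet hE ha]
  refine (hf.1.continuousAt.tendsto.mono_left nhdsWithin_le_nhds).congr' ?_
  filter_upwards [self_mem_nhdsWithin] with z hz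
  exact (coe_finitePart (apply_ne_infty_of_notMem_prepoleSet fun hzE => hz (hE hzE ha))).symm

end IsMeromorphicFun

/-! ### Limits of iterates along a commuting function -/

theorem IsHolomorphicSelfMap.eventually_eq_of_limit_notMem {f : ℂ → Sphere} {F : ℂ → ℂ}
    {U X : Set ℂ} {n : ℕ → ℕ} {φ : ℂ → ℂ} {z : ℂ} (h : IsHolomorphicSelfMap f F X) (hU : IsOpen U)
    (hUX : U ⊆ X) (hlim : TendstoLocallyUniformlyOn (fun k => F^[n k]) φ atTop U) (hz : z ∈ U)
    (hφ : φ z ∉ X) : ∀ᶠ x in 𝓝 z, φ x = φ z := by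
  by_contra hne
  obtain ⟨ε, hε, himage⟩ := exists_ball_subset_image_of_hurwitz hU
    (fun k => (h.differentiableOn_iterate (n k)).mono hUX) hlim hz hne (hU.mem_nhds hz)
  obtain ⟨k, hk⟩ := himage.exists
  obtain ⟨x, hx, hxφ⟩ := hk (mem_ball_self hε)
  exact hφ (hxφ ▸ h.mapsTo_iterate (n k) (hUX hx))

theorem exists_eq_of_tendsto_iterate_of_isPeriodicPt {α β : Type*} [TopologicalSpace β] [T1Space β]
    {F : α → α} {p : α} {m : ℕ} (hm : 0 < m) (hp : Function.IsPeriodicPt F m p) (c : α → β)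
    {n : ℕ → ℕ} {y : β} (hlim : Tendsto (fun k => c (F^[n k] p)) atTop (𝓝 y)) :
    ∃ i, c (F^[i] p) = y := by
  have hfin : ((fun i => c (F^[i] p)) '' Iio m).Finite := (finite_Iio m).image _
  obtain ⟨i, -, hi⟩ := hfin.isClosed.mem_of_tendsto hlim (.of_forall fun k =>
    ⟨n k % m, Nat.mod_lt _ hm, congrArg c (hp.iterate_mod_apply (n k))⟩)
  exact ⟨i, hi⟩

section CommutingLimit

variable {f g : ℂ → Sphere} {F : ℂ → ℂ} {U : Set ℂ} {n : ℕ → ℕ} {φ : ℂ → ℂ} {z₀ : ℂ}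

theorem IsHolomorphicSelfMap.coe_iterate_finitePart
    (h : IsHolomorphicSelfMap f F (prepoleSet f)ᶜ) (hfg : CommutingFun f g) {z : ℂ}
    (hz : z ∉ prepoleSet f) (n : ℕ) : (F^[n] (finitePart (g z)) : Sphere) = g (F^[n] z) := by
  rw [← h.iter_eq n (hfg.finitePart_notMem_prepoleSet hz), hfg.iter_finitePart hz, h.iter_eq n hz,
    finitePart_coe]

theorem IsHolomorphicSelfMap.compactlyBoundedAt_finitePart
    (h : IsHolomorphicSelfMap f F (prepoleSet f)ᶜ) (hg : IsMeromorphicFun g)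
    (hg_nonconst : ¬ ∃ c : Sphere, ∀ z, g z = c) (hfg : CommutingFun f g) (hU : IsOpen U)
    (hUE : U ⊆ (prepoleSet f)ᶜ) (hlim : TendstoLocallyUniformlyOn (fun k => F^[n k]) φ atTop U)
    (hz₀ : z₀ ∈ U) (hφ : φ z₀ ∉ prepoleSet f) :
    CompactlyBoundedAt F (prepoleSet f)ᶜ n (finitePart (g z₀)) := by
  obtain ⟨A, hA_nhds, hAE, hA⟩ := local_compact_nhds
    (h.isOpen.mem_nhds (hfg.finitePart_notMem_prepoleSet hφ))
  have hφU : ContinuousOn φ U := hlim.continuousOn (.of_forall fun k =>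
    (h.differentiableOn_iterate (n k)).continuousOn.mono hUE)
  have hgF : Tendsto (fun p : ℕ × ℂ => finitePart (g (F^[n p.1] p.2))) (atTop ×ˢ 𝓝 z₀)
      (𝓝 (finitePart (g (φ z₀)))) :=
    (hg.analyticAt_finitePart (hfg.apply_ne_infty hφ)).continuousAt.tendsto.comp
      (tendsto_prod_nhds_of_tendstoLocallyUniformlyOn hlim hU hφU hz₀)
  obtain ⟨P, hP, Q, hQ, hPQ⟩ := eventually_prod_iff.1 (hgF.eventually hA_nhds)
  refine ⟨(fun z => finitePart (g z)) '' ({z | Q z} ∩ U),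
    hg.nhds_le_map hg_nonconst (hfg.apply_ne_infty (hUE hz₀))
      (image_mem_map (inter_mem hQ (hU.mem_nhds hz₀))), A, hAE, hA, ?_⟩
  filter_upwards [hP] with k hk
  rintro _ ⟨z, ⟨hzQ, hzU⟩, rfl⟩
  have hzA : finitePart (g (F^[n k] z)) ∈ A := hPQ hk hzQ
  rwa [← h.coe_iterate_finitePart hfg (hUE hzU), finitePart_coe] at hzA

theorem IsHolomorphicSelfMap.mem_fatouSet_of_limit_mem_prepoleSet
    (h : IsHolomorphicSelfMap f F (prepoleSet f)ᶜ) (hE : (prepoleSet f).Subsingleton)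
    (hg : IsMeromorphicFun g) (hg_nonconst : ¬ ∃ c : Sphere, ∀ z, g z = c)
    (hfg : CommutingFun f g) (hU : IsOpen U) (hUE : U ⊆ (prepoleSet f)ᶜ)
    (hlim : TendstoLocallyUniformlyOn (fun k => F^[n k]) φ atTop U)
    (hz₀ : z₀ ∈ U) (hφ : φ z₀ ∈ prepoleSet f) : finitePart (g z₀) ∈ fatouSet f := by
  by_contra hJ
  have hconst := h.eventually_eq_of_limit_notMem hU hUE hlim hz₀ (notMem_compl_iff.2 hφ)
  obtain ⟨_, ⟨z, ⟨hφz, hzU⟩, rfl⟩, m, hm, hper⟩ := h.exists_periodic_of_notMem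
    (notMem_compl_iff.2 hφ) (hfg.finitePart_notMem_prepoleSet (hUE hz₀)) hJ
    (hg.nhds_le_map hg_nonconst (hfg.apply_ne_infty (hUE hz₀))
      (image_mem_map (inter_mem hconst (hU.mem_nhds hz₀))))
  have hgφ : g (φ z) = OnePoint.infty := (hfg.apply_eq_infty_iff _).1
    (apply_eq_infty_of_mem_prepoleSet hE (hφz ▸ hφ))
  have horbit : Tendsto (fun k => (F^[n k] (finitePart (g z)) : Sphere)) atTop
      (𝓝 OnePoint.infty) := by
    simp only [h.coe_iterate_finitePart hfg (hUE hzU), ← hgφ]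
    exact (hg.1.tendsto _).comp (hlim.tendsto_at hzU)
  obtain ⟨i, hi⟩ := exists_eq_of_tendsto_iterate_of_isPeriodicPt hm hper ((↑) : ℂ → Sphere) horbit
  exact OnePoint.coe_ne_infty _ hi

end CommutingLimit

theorem theorem1p1_general (f g : ℂ → Sphere) (hf : IsMeromorphicFun f) (hg : IsMeromorphicFun g)
    (hg_nonconst : ¬ ∃ c : Sphere, ∀ z, g z = c) (hfg : CommutingFun f g)
    (U : Set ℂ) (hU : IsOpen U)
    (hlim : ∃ n : ℕ → ℕ, StrictMono n ∧ ∃ φ : ℂ → ℂ,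
      TendstoLocallyUniformlyOn (fun k => iter f (n k)) (fun z => ((φ z : ℂ) : Sphere)) atTop U) :
    g '' U ⊆ ((↑) : ℂ → Sphere) '' fatouSet f := by
  obtain ⟨n, hn, φ, hφ⟩ := hlim
  have hUE : U ⊆ (prepoleSet f)ᶜ := fun z hz =>
    notMem_prepoleSet_of_tendsto_iter hn (hφ.tendsto_at hz)
  rintro _ ⟨z₀, hz₀, rfl⟩
  refine ⟨finitePart (g z₀), ?_, coe_finitePart (hfg.apply_ne_infty (hUE hz₀))⟩
  by_cases hE : (prepoleSet f).Subsingleton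
  · have hself := hf.isHolomorphicSelfMap hE.isClosed
    have hlim := (hf.tendstoLocallyUniformlyOn_finitePart_iter hU hUE hφ).congr fun k z hz =>
      congrArg finitePart (hself.iter_eq (n k) (hUE hz))
    by_cases hφE : φ z₀ ∈ prepoleSet f
    · exact hself.mem_fatouSet_of_limit_mem_prepoleSet hE hg hg_nonconst hfg hU hUE hlim hz₀ hφE
    · by_contra hJ
      exact hself.not_compactlyBoundedAt_of_notMem ((compl_compl (prepoleSet f)).symm ▸ hE)
        (fun a ha => hf.tendsto_cobounded hE (notMem_compl_iff.1 ha)) hn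
        (hfg.finitePart_notMem_prepoleSet (hUE hz₀)) hJ
        (hself.compactlyBoundedAt_finitePart hg hg_nonconst hfg hU hUE hlim hz₀ hφE)
  · refine hf.mem_fatouSet_of_not_subsingleton hE
      (hg.nhds_le_map hg_nonconst (hfg.apply_ne_infty (hUE hz₀)) (mem_map.2 ?_))
    filter_upwards [hU.mem_nhds hz₀] with z hz
    exact hfg.finitePart_notMem_prepoleSet (hUE hz)

theorem theorem1p1 (f g : ℂ → Sphere) (hf : IsMeromorphicFun f) (hg : IsMeromorphicFun g)
    (hg_nonconst : ¬ ∃ c : Sphere, ∀ z, g z = c) (hfg : CommutingFun f g)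
    (U : Set ℂ) (hU : IsFatouComponent f U)
    (hlim : ∃ n : ℕ → ℕ, StrictMono n ∧ ∃ φ : ℂ → ℂ,
      TendstoLocallyUniformlyOn (fun k => iter f (n k)) (fun z => ((φ z : ℂ) : Sphere)) atTop U) :
    g '' U ⊆ ((↑) : ℂ → Sphere) '' fatouSet f := by
  obtain ⟨z, -, rfl⟩ := hU
  exact theorem1p1_general f g hf hg hg_nonconst hfg _ (isOpen_fatouSet f).connectedComponentIn hlim
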